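/- Let $q$ be a prime power, $G=\mathrm{SL}_2(\mathbb F_q)$, and let $G$ act on $\mathbb F_q[X,Y]$ by the algebra automorphisms $\begin{pmatrix}a&b\\c&d\end{pmatrix}\cdot X^iY^j=(aX+cY)^i(bX+dY)^j$. The Steinberg module $\overline{\mathrm{st}}$ is the $G$-stable $\mathbb F_q$-span of the monomials $X^iY^{q-1-i}$, $0\le i\le q-1$, with $\binom{q-1}{i}\ne 0$ in $\mathbb F_q$. Let $\kappa$ be a finite extension of $\mathbb F_q$ of even degree (so $\kappa\supseteq\mathbb F_{q^2}$), let $\alpha$ be a generator of $\kappa^\times$, let $\xi\in\mathbb C^\times$ be a root of unity of exact order $\#\kappa^\times$, and let $\chi:\kappa\to\mathbb C$ be the homomorphism of multiplicative monoids with $\chi(\alpha)=\xi$ and $\chi(0)=0$. For a finite-dimensional $\mathbb F_q[G]$-module $\overline V$ and $g\in G$ of order prime to the characteristic of $\mathbb F_q$, let $\psi_{\overline V}(g)=\sum_i\chi(\lambda_i)$, where the $\lambda_i\in\kappa$ are the eigenvalues of $g$ on $\overline V\otimes_{\mathbb F_q}\kappa$, counted with algebraic multiplicity (the Brauer character of $\overline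 V$). For $n\in\{q-1,q+1\}$ let $\mu_n=\{\zeta\in\kappa^\times:\zeta^n=1\}$, and for $\zeta\in\mu_{q-1}\cup\mu_{q+1}$ let $A_\zeta\in G$ be $\pm I_2$ if $\zeta=\pm1$, and $A_\zeta=\begin{pmatrix}0&-1\\1&\zeta+\zeta^{-1}\end{pmatrix}$ otherwise (note that $\zeta+\zeta^{-1}\in\mathbb F_q$). Theorem. For every finite-dimensional $\mathbb F_q[G]$-module $\overline V$, $$\dim_{\mathbb F_q}\mathrm{Hom}_{\mathbb F_q[G]}(\overline{\mathrm{st}},\overline V)=\frac12\Big(\frac1{q-1}\sum_{\zeta\in\mu_{q-1}}\psi_{\overline V}(A_\zeta)-\frac1{q+1}\sum_{\zeta\in\mu_{q+1}}\psi_{\overline V}(A_\zeta)\Big).$$ -/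

import Mathlib

noncomputable section

namespace SLTwo

open Matrix

/-- The action of `SL₂(F)` on `F[X, Y]` (with `X = X 0`, `Y = X 1`) by linear substitutions:
`(a, b; c, d) • (X ^ i * Y ^ j) = (a X + c Y) ^ i * (b X + d Y) ^ j`. -/
def polyRep (F : Type*) [Field F] :
    Representation F (SpecialLinearGroup (Fin 2) F) (MvPolynomial (Fin 2) F) where
  toFun g := (MvPolynomial.aeval (R := F) (fun j : Fin 2 =>
    g.1 0 j • (MvPolynomial.X 0 : MvPolynomial (Fin 2) F) + g.1 1 j • MvPolynomial.X 1)).toLinearMap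
  map_one' := by
    have h : (MvPolynomial.aeval (R := F) (fun j : Fin 2 =>
        (1 : SpecialLinearGroup (Fin 2) F).1 0 j • (MvPolynomial.X 0 : MvPolynomial (Fin 2) F)
          + (1 : SpecialLinearGroup (Fin 2) F).1 1 j • MvPolynomial.X 1)) = AlgHom.id F _ := by
      apply MvPolynomial.algHom_ext
      intro j
      fin_cases j <;> simp
    rw [h]
    rfl
  map_mul' g h := by
    rw [Module.End.mul_eq_comp, ← AlgHom.comp_toLinearMap]
    congr 1
    apply MvPolynomial.algHom_ext
    intro j
    have hm : ∀ i, (g * h).1 i j = g.1 i 0 * h.1 0 j + g.1 i 1 * h.1 1 j := fun i => by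
      change (g.1 * h.1) i j = _
      rw [Matrix.mul_apply, Fin.sum_univ_two]
    simp only [MvPolynomial.aeval_X, AlgHom.comp_apply, map_add, map_smul, hm]
    module

/-- The `F`-span of the monomials `X ^ i * Y ^ (k - i)`, `0 ≤ i ≤ k`, such that the binomial
coefficient `k.choose i` is non-zero in `F`. -/
def simpleSubmodule (F : Type*) [Field F] (k : ℕ) : Submodule F (MvPolynomial (Fin 2) F) :=
  Submodule.span F
    {f | ∃ i : ℕ, i ≤ k ∧ ((k.choose i : ℕ) : F) ≠ 0 ∧
      f = MvPolynomial.X 0 ^ i * MvPolynomial.X 1 ^ (k - i)}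

theorem choose_smul_mem (F : Type*) [Field F] (k j : ℕ) (hj : j ≤ k) :
    ((k.choose j : ℕ) : F) • (MvPolynomial.X 0 ^ j * MvPolynomial.X 1 ^ (k - j) :
      MvPolynomial (Fin 2) F) ∈ simpleSubmodule F k := by
  by_cases h : ((k.choose j : ℕ) : F) = 0
  · rw [h, zero_smul]
    exact Submodule.zero_mem _
  · exact Submodule.smul_mem _ _ (Submodule.subset_span ⟨j, hj, h, rfl⟩)

theorem coeff_linear_pow {R : Type*} [CommRing R] (u v : R) (k i : ℕ) (hi : i ≤ k) :
    ((Polynomial.C u * Polynomial.X + Polynomial.C v) ^ k).coeff i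
      = u ^ i * v ^ (k - i) * (k.choose i : ℕ) := by
  have h : (Polynomial.C u * Polynomial.X + Polynomial.C v) ^ k
      = ∑ m ∈ Finset.range (k + 1),
        Polynomial.C (u ^ m * v ^ (k - m) * (k.choose m : ℕ)) * Polynomial.X ^ m := by
    rw [add_pow]
    refine Finset.sum_congr rfl fun m _ => ?_
    simp only [map_mul, map_pow, map_natCast]
    ring
  rw [h, Polynomial.finsetSum_coeff]
  simp only [Polynomial.coeff_C_mul_X_pow]
  rw [Finset.sum_ite_eq, if_pos (Finset.mem_range.2 (by omega))]

theorem polyRep_mem_simpleSubmodule {F : Type*} [Field F] (k : ℕ)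
    (g : SpecialLinearGroup (Fin 2) F) ⦃f : MvPolynomial (Fin 2) F⦄
    (hf : f ∈ simpleSubmodule F k) : polyRep F g f ∈ simpleSubmodule F k := by
  suffices h : simpleSubmodule F k ≤ (simpleSubmodule F k).comap (polyRep F g) from h hf
  refine Submodule.span_le.2 ?_
  rintro _ ⟨i, hi, hne, rfl⟩
  let x : MvPolynomial (Fin 2) F := MvPolynomial.X 0
  let y : MvPolynomial (Fin 2) F := MvPolynomial.X 1
  let u : MvPolynomial (Fin 2) F := g.1 0 0 • x + g.1 1 0 • y
  let v : MvPolynomial (Fin 2) F := g.1 0 1 • x + g.1 1 1 • y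
  have hg : polyRep F g (x ^ i * y ^ (k - i)) = u ^ i * v ^ (k - i) := by
    change MvPolynomial.aeval _ _ = _
    simp [x, y, u, v]
  let s : ℕ → Polynomial F := fun j =>
    (Polynomial.C (g.1 0 0) * Polynomial.X + Polynomial.C (g.1 0 1)) ^ j
      * (Polynomial.C (g.1 1 0) * Polynomial.X + Polynomial.C (g.1 1 1)) ^ (k - j)
  have key : (Polynomial.C u * Polynomial.X + Polynomial.C v) ^ k
      = ∑ j ∈ Finset.range (k + 1), Polynomial.C ((k.choose j : ℕ) * (x ^ j * y ^ (k - j)))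
          * (s j).map (MvPolynomial.C : F →+* MvPolynomial (Fin 2) F) := by
    have h1 : Polynomial.C u * Polynomial.X + Polynomial.C v
        = Polynomial.C x * (Polynomial.C (MvPolynomial.C (g.1 0 0)) * Polynomial.X
            + Polynomial.C (MvPolynomial.C (g.1 0 1)))
          + Polynomial.C y * (Polynomial.C (MvPolynomial.C (g.1 1 0)) * Polynomial.X
            + Polynomial.C (MvPolynomial.C (g.1 1 1))) := by
      simp only [u, v, MvPolynomial.smul_eq_C_mul, map_add, map_mul]
      ring
    simp only [h1, add_pow (Polynomial.C x * _), mul_pow]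
    refine Finset.sum_congr rfl fun m _ => ?_
    simp only [s, Polynomial.map_mul, Polynomial.map_pow, Polynomial.map_add, Polynomial.map_C,
      Polynomial.map_X, map_mul, map_pow, map_natCast]
    ring
  have hc := congrArg (fun P => Polynomial.coeff P i) key
  simp only [coeff_linear_pow u v k i hi, Polynomial.finsetSum_coeff, Polynomial.coeff_C_mul,
    Polynomial.coeff_map] at hc
  have hmem : ((k.choose i : ℕ) : F) • (u ^ i * v ^ (k - i)) ∈ simpleSubmodule F k := by
    have h2 : ((k.choose i : ℕ) : F) • (u ^ i * v ^ (k - i))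
        = u ^ i * v ^ (k - i) * ((k.choose i : ℕ) : MvPolynomial (Fin 2) F) := by
      rw [MvPolynomial.smul_eq_C_mul, map_natCast, mul_comm]
    rw [h2, hc]
    refine Submodule.sum_mem _ fun j hj => ?_
    have h3 : ((k.choose j : ℕ) : MvPolynomial (Fin 2) F) * (x ^ j * y ^ (k - j))
          * MvPolynomial.C ((s j).coeff i)
        = (s j).coeff i • (((k.choose j : ℕ) : F) • (x ^ j * y ^ (k - j))) := by
      rw [MvPolynomial.smul_eq_C_mul, MvPolynomial.smul_eq_C_mul, map_natCast, mul_comm]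
    rw [h3]
    exact Submodule.smul_mem _ _
      (choose_smul_mem F k j (Nat.lt_succ_iff.1 (Finset.mem_range.1 hj)))
  change polyRep F g (x ^ i * y ^ (k - i)) ∈ simpleSubmodule F k
  rw [hg]
  exact (Submodule.smul_mem_iff _ hne).1 hmem

/-- The representation `L_k` of `SL₂(F)`, as a subrepresentation of `F[X, Y]`. -/
def simpleSubrep (F : Type*) [Field F] (k : ℕ) : Subrepresentation (polyRep F) where
  toSubmodule := simpleSubmodule F k
  apply_mem_toSubmodule g _ hf := polyRep_mem_simpleSubmodule k g hf

/-- The Steinberg module of `SL₂(𝔽_q)`: the representation `L_{q - 1}`. -/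
def steinberg (F : Type*) [Field F] [Fintype F] :
    Representation F (SpecialLinearGroup (Fin 2) F) (simpleSubmodule F (Fintype.card F - 1)) :=
  (simpleSubrep F (Fintype.card F - 1)).toRepresentation

open scoped Classical in
/-- For a generator `α` of `κˣ` and a root of unity `ξ ∈ ℂ` of exact order `#κˣ`: the homomorphism
of multiplicative monoids `κ → ℂ` that maps `α` to `ξ` and `0` to `0`. -/
def rootLift {κ : Type*} [Field κ] [Fintype κ] (α : κˣ) (hα : ∀ x : κˣ, x ∈ Subgroup.zpowers α)
    (ξ : ℂˣ) (hξ : IsPrimitiveRoot ξ (Nat.card κˣ)) : MulChar κ ℂ :=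
  MulChar.ofRootOfUnity (ζ := ξ)
    ((mem_rootsOfUnity _ ξ).2 (by rw [← Nat.card_eq_fintype_card, hξ.pow_eq_one])) hα

/-- The value at `g` of the Brauer character of a finite-dimensional representation `ρ` over `F`,
for a multiplicative lift `χ` of `κ ⊇ F` to `ℂ`: the sum of the lifts of the eigenvalues of `ρ g`
in `κ`, with multiplicity. It is meaningful at the elements `g` of order prime to the
characteristic all of whose eigenvalues on the representation lie in `κ`. -/
def brauerCharacter {F κ G V : Type*} [Field F] [Field κ] [Algebra F κ] [Group G]
    [AddCommGroup V] [Module F V] [Module.Finite F V] (χ : MulChar κ ℂ)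
    (ρ : Representation F G V) (g : G) : ℂ :=
  (((ρ g).charpoly.map (algebraMap F κ)).roots.map χ).sum

/-- The element of `F` whose image in `κ` is `ζ + ζ⁻¹`, if there is one (and `0` otherwise). -/
def torusTrace (F : Type*) {κ : Type*} [Field F] [Field κ] [Algebra F κ] (ζ : κ) : F :=
  open scoped Classical in
  if h : ∃ b : F, algebraMap F κ b = ζ + ζ⁻¹ then h.choose else 0

/-- `ζ + ζ⁻¹` does lie in `F = 𝔽_q` if `ζ` is a `(q - 1)`-th or a `(q + 1)`-th root of unity. -/
theorem algebraMap_torusTrace {F κ : Type*} [Field F] [Fintype F] [Field κ] [Fintype κ]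
    [Algebra F κ] (ζ : κ)
    (hζ : ζ ^ (Fintype.card F - 1) = 1 ∨ ζ ^ (Fintype.card F + 1) = 1) :
    algebraMap F κ (torusTrace F ζ) = ζ + ζ⁻¹ := by
  have hq : 1 < Fintype.card F := Fintype.one_lt_card
  have h0 : ζ ≠ 0 := by
    rintro rfl
    rcases hζ with h | h
    · rw [zero_pow (by omega)] at h
      exact zero_ne_one h
    · rw [zero_pow (by omega)] at h
      exact zero_ne_one h
  have hfix : (ζ + ζ⁻¹) ^ Fintype.card F = ζ + ζ⁻¹ := by
    have hadd : (ζ + ζ⁻¹) ^ Fintype.card F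
        = ζ ^ Fintype.card F + (ζ⁻¹) ^ Fintype.card F :=
      map_add (FiniteField.frobeniusAlgHom F κ) ζ ζ⁻¹
    rw [hadd, inv_pow]
    rcases hζ with h | h
    · have h1 : ζ ^ Fintype.card F = ζ := by
        rw [show Fintype.card F = Fintype.card F - 1 + 1 by omega, pow_succ, h, one_mul]
      rw [h1]
    · have h1 : ζ ^ Fintype.card F = ζ⁻¹ := by
        rw [pow_succ] at h
        exact eq_inv_of_mul_eq_one_left h
      rw [h1, inv_inv, add_comm]
  have hex : ∃ b : F, algebraMap F κ b = ζ + ζ⁻¹ := by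
    have hroot : ζ + ζ⁻¹ ∈ ((Polynomial.X ^ Fintype.card F - Polynomial.X :
        Polynomial F).map (algebraMap F κ)).roots := by
      rw [Polynomial.mem_roots (Polynomial.map_ne_zero
        (FiniteField.X_pow_card_sub_X_ne_zero F hq))]
      simp [Polynomial.IsRoot, hfix]
    have hsplit : (Polynomial.X ^ Fintype.card F - Polynomial.X : Polynomial F).roots.map
        (algebraMap F κ) = ((Polynomial.X ^ Fintype.card F - Polynomial.X :
        Polynomial F).map (algebraMap F κ)).roots := by
      apply Polynomial.roots_map_of_injective_of_card_eq_natDegree (algebraMap F κ).injective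
      rw [FiniteField.roots_X_pow_card_sub_X, FiniteField.X_pow_card_sub_X_natDegree_eq F hq]
      rfl
    rw [← hsplit] at hroot
    obtain ⟨b, _, hb⟩ := Multiset.mem_map.1 hroot
    exact ⟨b, hb⟩
  rw [torusTrace, dif_pos hex]
  exact hex.choose_spec

/-- The matrix `A_ζ ∈ SL₂(F)`: it is `± 1` if `ζ = ± 1`, and `(0, -1; 1, ζ + ζ⁻¹)` otherwise. -/
def torusMatrix (F : Type*) {κ : Type*} [Field F] [Field κ] [Algebra F κ] (ζ : κ) :
    SpecialLinearGroup (Fin 2) F :=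
  open scoped Classical in
  if ζ = 1 then 1
  else if ζ = -1 then -1
  else ⟨!![0, -1; 1, torusTrace F ζ], by simp [Matrix.det_fin_two]⟩

end SLTwo

end

/-! Write `q` for the order of `F`, `K` for its quadratic extension, and `P(L)` for the projective
line over `L`. All permutation modules below split off the constants, because `P(F)` and `P(K)` have
`q + 1` and `q ^ 2 + 1` points, which is `1` in characteristic `p`.

The `(q - 1)`-th powers of linear forms over `F` span the Steinberg module, are permuted by `G` like
`P(F)`, and have zero sum as their only relation. So `Hom(st, V)` is the space of equivariant maps
`P(F) → V` with sum zero (`restrictPoints_bijective`); let `s` be its dimension.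

`P(F) × P(F)` is the diagonal plus one orbit `G/T` with `T` the split torus of order `q - 1`, and
`P(K)` is `P(F)` plus one orbit `G/T'` with `T'` the nonsplit torus of order `q + 1`. Counting
equivariant maps on both sets in two ways gives `dim V^T = s + d` and `dim V^T' = d' - s`, where `d`
counts the maps on pairs with zero row and column sums and `d'` the maps on `P(K)` with zero sum.
The central point is `d = d'` (`finrank_doublySumZeroMaps`): it reflects the isomorphism of `st ⊗
st` with the restriction to `G` of the Steinberg module of `SL₂(K)`, made explicit by the invariant
`kernel`. Hence `dim V^T - dim V^T' = 2 s` (`finrank_fixedVectors_split`).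

Both tori are cyclic of order prime to `p`, so the average of the Brauer character over each is the
dimension of its fixed space (`sum_brauerCharacter_eq`). The kernel and the eigenvalues need scalars
containing `K`, whence the passage to `κ`, which does not change `s`. -/

noncomputable section

namespace SLTwo

open Matrix Module
open scoped LinearAlgebra.Projectivization

/-! ### Equivariant maps from a `G`-set to a representation -/

section Equivariant

variable {k G W X : Type*} [Field k] [Group G] [AddCommGroup W] [Module k W] [MulAction G X]

/-- The space of equivariant maps from a `G`-set to a representation of `G`. -/
def equivariantMaps (ρ : Representation k G W) (X : Type*) [MulAction G X] :
    Submodule k (X → W) where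
  carrier := {f | ∀ (g : G) (x : X), f (g • x) = ρ g (f x)}
  add_mem' hf hf' g x := by simp [hf g x, hf' g x]
  zero_mem' g x := by simp
  smul_mem' c f hf g x := by simp [hf g x]

/-- The space of vectors fixed by a subgroup. -/
def fixedVectors (ρ : Representation k G W) (H : Subgroup G) : Submodule k W where
  carrier := {w | ∀ h ∈ H, ρ h w = w}
  add_mem' hw hw' h hh := by rw [map_add, hw h hh, hw' h hh]
  zero_mem' h _ := map_zero _
  smul_mem' c w hw h hh := by rw [map_smul, hw h hh]

/-- Rank-nullity for `e` restricted to `S`. The section `s` only witnesses surjectivity, so it need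
not be linear and may be defined by choice. -/
theorem finrank_eq_add_finrank_inf_ker {M N : Type*} [AddCommGroup M] [Module k M]
    [AddCommGroup N] [Module k N] {S : Submodule k M} [Module.Finite k S] {T : Submodule k N}
    (e : M →ₗ[k] N) (s : N → M) (he : ∀ x ∈ S, e x ∈ T) (hs : ∀ y ∈ T, s y ∈ S)
    (hes : ∀ y ∈ T, e (s y) = y) :
    finrank k S = finrank k T + finrank k (S ⊓ LinearMap.ker e : Submodule k M) := by
  let e' : S →ₗ[k] T := e.restrict he
  have hsurj : LinearMap.range e' = ⊤ := LinearMap.range_eq_top.2 fun y =>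
    ⟨⟨s y, hs y y.2⟩, Subtype.ext (hes y y.2)⟩
  rw [← LinearMap.finrank_range_add_finrank_ker e', hsurj, finrank_top]
  congr 1
  have hker : LinearMap.ker e' = (S ⊓ LinearMap.ker e).comap S.subtype := by
    ext x
    simp [e', Subtype.ext_iff]
  rw [hker]
  exact (Submodule.comapSubtypeEquivOfLe inf_le_left).finrank_eq

theorem finrank_eq_of_inverse {M N : Type*} [AddCommGroup M] [Module k M]
    [AddCommGroup N] [Module k N] {S : Submodule k M} {T : Submodule k N}
    (e : M →ₗ[k] N) (s : N → M) (he : ∀ x ∈ S, e x ∈ T) (hs : ∀ y ∈ T, s y ∈ S)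
    (hes : ∀ y ∈ T, e (s y) = y) (hse : ∀ x ∈ S, s (e x) = x) :
    finrank k S = finrank k T := by
  refine (LinearEquiv.ofBijective (e.restrict he) ⟨fun x y hxy => ?_, fun y =>
    ⟨⟨s y, hs y y.2⟩, Subtype.ext (hes y y.2)⟩⟩).finrank_eq
  have h : e x = e y := congrArg Subtype.val hxy
  exact Subtype.ext (by rw [← hse x x.2, h, hse y y.2])

/-- The maps that vanish outside a given subset. -/
def supportedMaps (k W : Type*) [Field k] [AddCommGroup W] [Module k W] (s : Set X) :
    Submodule k (X → W) where
  carrier := {f | ∀ x ∉ s, f x = 0}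
  add_mem' hf hf' x hx := by simp [hf x hx, hf' x hx]
  zero_mem' x _ := rfl
  smul_mem' c f hf x hx := by simp [hf x hx]

theorem mem_supportedMaps {s : Set X} {f : X → W} :
    f ∈ supportedMaps k W s ↔ ∀ x ∉ s, f x = 0 := Iff.rfl

open scoped Classical in
-- Frobenius reciprocity: an equivariant map on an orbit is determined by its value at `z`, and any
-- vector fixed by the stabilizer of `z` can occur.
theorem finrank_equivariantMaps_orbit (ρ : Representation k G W) (z : X) :
    finrank k (equivariantMaps ρ X ⊓ supportedMaps k W (MulAction.orbit G z) :
      Submodule k (X → W)) = finrank k (fixedVectors ρ (MulAction.stabilizer G z)) := by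
  have hval : ∀ w ∈ fixedVectors ρ (MulAction.stabilizer G z), ∀ g g' : G, g • z = g' • z →
      ρ g w = ρ g' w := fun w hw g g' h => by
    have h1 := hw (g'⁻¹ * g) (by rw [MulAction.mem_stabilizer_iff, mul_smul, h, inv_smul_smul])
    rw [← mul_inv_cancel_left g' g, map_mul, Module.End.mul_apply, h1]
  let s : W → X → W := fun w x =>
    if h : ∃ g : G, g • z = x then ρ h.choose w else 0
  have hs : ∀ w ∈ fixedVectors ρ (MulAction.stabilizer G z), ∀ g : G, s w (g • z) = ρ g w :=
    fun w hw g => by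
      have h : ∃ g' : G, g' • z = g • z := ⟨g, rfl⟩
      simp only [s, dif_pos h]
      exact hval w hw _ _ h.choose_spec
  have hs0 : ∀ w, ∀ x ∉ MulAction.orbit G z, s w x = 0 := fun w x hx => by
    have h : ¬ ∃ g' : G, g' • z = x := hx
    simp only [s, dif_neg h]
  refine finrank_eq_of_inverse (LinearMap.proj z) s ?_ ?_ ?_ ?_
  · rintro f ⟨hf, -⟩ h hh
    rw [LinearMap.proj_apply, ← hf, MulAction.mem_stabilizer_iff.1 hh]
  · refine fun w hw => ⟨fun g x => ?_, fun x hx => hs0 w x hx⟩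
    by_cases hx : x ∈ MulAction.orbit G z
    · obtain ⟨g', rfl⟩ := hx
      simp only
      rw [← mul_smul, hs w hw, hs w hw, map_mul, Module.End.mul_apply]
    · rw [hs0 w x hx, hs0 w _ (fun hgx => hx (by
        rwa [← MulAction.orbit_eq_iff, MulAction.orbit_smul, MulAction.orbit_eq_iff] at hgx)), map_zero]
  · intro w hw
    have := hs w hw 1
    rw [one_smul] at this
    simp [this]
  · rintro f ⟨hf, hf0⟩
    have hw : f z ∈ fixedVectors ρ (MulAction.stabilizer G z) := fun h hh => by
      rw [← hf, MulAction.mem_stabilizer_iff.1 hh]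
    funext x
    by_cases hx : x ∈ MulAction.orbit G z
    · obtain ⟨g', rfl⟩ := hx
      simp only [LinearMap.proj_apply]
      rw [hs _ hw, hf]
    · rw [hs0 _ x hx, hf0 x hx]

end Equivariant

/-! ### Points of the projective line -/

section Points

variable {F L : Type*} [Field L]

/-- The points of the projective line over `L`, with the action of `SL₂(F)`. -/
def Points (_F L : Type*) [Field L] : Type _ := ℙ L (Fin 2 → L)

/-- A vector of homogeneous coordinates of a point. -/
def Points.rep (p : Points F L) : Fin 2 → L := Projectivization.rep (K := L) p

/-- The point with given homogeneous coordinates. -/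
def Points.mk (F : Type*) {L : Type*} [Field L] (v : Fin 2 → L) (hv : v ≠ 0) : Points F L :=
  Projectivization.mk L v hv

theorem Points.rep_ne_zero (p : Points F L) : p.rep ≠ 0 := Projectivization.rep_nonzero _

theorem Points.mk_rep (p : Points F L) : Points.mk F p.rep p.rep_ne_zero = p :=
  Projectivization.mk_rep _

theorem Points.mk_eq_mk_iff {v w : Fin 2 → L} {hv : v ≠ 0} {hw : w ≠ 0} :
    Points.mk F v hv = Points.mk F w hw ↔ ∃ a : L, a • w = v :=
  Projectivization.mk_eq_mk_iff' ..

theorem Points.exists_rep_mk (v : Fin 2 → L) (hv : v ≠ 0) :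
    ∃ a : L, a ≠ 0 ∧ (Points.mk F v hv).rep = a • v := by
  obtain ⟨a, ha⟩ := Projectivization.exists_smul_eq_mk_rep L v hv
  exact ⟨a, a.ne_zero, ha.symm⟩

instance [Finite L] : Finite (Points F L) := 
  inferInstanceAs (Finite (ℙ L (Fin 2 → L)))

instance [Finite L] : Fintype (Points F L) := Fintype.ofFinite _

theorem card_points [Fintype L] : Fintype.card (Points F L) = Fintype.card L + 1 := by
  classical
  have hL : 1 < Fintype.card L := Fintype.one_lt_card
  have h := Projectivization.card_of_finrank_two L (Fin 2 → L) (by simp)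
  rw [Nat.card_eq_fintype_card (α := L)] at h
  rw [← h, ← Nat.card_eq_fintype_card]
  rfl

/-- The determinant of a pair of vectors in the plane. -/
def cross {R : Type*} [CommRing R] (v w : Fin 2 → R) : R := v 0 * w 1 - v 1 * w 0

theorem cross_smul_left {R : Type*} [CommRing R] (a : R) (v w : Fin 2 → R) :
    cross (a • v) w = a * cross v w := by
  simp only [cross, Pi.smul_apply, smul_eq_mul]; ring

theorem cross_smul_right {R : Type*} [CommRing R] (a : R) (v w : Fin 2 → R) :
    cross v (a • w) = a * cross v w := by
  simp only [cross, Pi.smul_apply, smul_eq_mul]; ring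

theorem cross_eq_zero_iff {v w : Fin 2 → L} (hw : w ≠ 0) :
    cross v w = 0 ↔ ∃ a : L, a • w = v := by
  constructor
  · intro h
    rw [cross] at h
    by_cases h0 : w 0 = 0
    · have h1 : w 1 ≠ 0 := fun h1 => hw (by funext i; fin_cases i <;> simp [h0, h1])
      refine ⟨v 1 / w 1, funext fun i => ?_⟩
      fin_cases i
      · have : v 0 = 0 := by simpa [h0, h1] using h
        simp [h0, this]
      · simp [h1]
    · refine ⟨v 0 / w 0, funext fun i => ?_⟩
      fin_cases i
      · simp [h0]
      · simp only [Fin.mk_one, Pi.smul_apply, smul_eq_mul]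
        field_simp
        linear_combination h
  · rintro ⟨a, rfl⟩
    rw [cross_smul_left, cross]; ring

theorem Points.mk_eq_mk_iff_cross {v w : Fin 2 → L} {hv : v ≠ 0} {hw : w ≠ 0} :
    Points.mk F v hv = Points.mk F w hw ↔ cross v w = 0 := by
  rw [cross_eq_zero_iff hw, Points.mk_eq_mk_iff]

theorem Points.eq_iff_cross {p p' : Points F L} : p = p' ↔ cross p.rep p'.rep = 0 := by
  conv_lhs => rw [← p.mk_rep, ← p'.mk_rep]
  exact Points.mk_eq_mk_iff_cross

/-- The nonzero vectors are partitioned into punctured lines of `|L| - 1` elements, on each of which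
`h` is constant. -/
theorem sum_points {M : Type*} [AddCommGroup M] [Fintype L] (h : (Fin 2 → L) → M)
    (h0 : h 0 = 0) (hh : ∀ (c : L) (v : Fin 2 → L), c ≠ 0 → h (c • v) = h v) :
    ∑ v, h v = (Fintype.card L - 1) • ∑ p : Points F L, h p.rep := by
  classical
  rw [← Fintype.card_units, ← Finset.card_univ, ← Finset.sum_const, ← Finset.sum_product',
    ← Finset.sum_subset (Finset.subset_univ (Finset.univ.filter (fun v => v ≠ 0)))
      (fun v _ hv => by
        have : v = 0 := by simpa using hv
        rw [this, h0])]
  symm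
  refine Finset.sum_bij (fun (a : Lˣ × Points F L) _ => (a.1 : L) • a.2.rep) ?_ ?_ ?_ ?_
  · intro a _
    simp [a.2.rep_ne_zero]
  · rintro ⟨u, p⟩ _ ⟨u', p'⟩ _ heq
    simp only at heq
    have hp : p = p' := by
      rw [← p.mk_rep, ← p'.mk_rep]
      exact Points.mk_eq_mk_iff.2 ⟨(u : L)⁻¹ * u', by rw [mul_smul, ← heq, inv_smul_smul₀ u.ne_zero]⟩
    subst hp
    have hu : (u : L) = u' := smul_left_injective L p.rep_ne_zero heq
    rw [Units.ext hu]
  · intro v hv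
    have hv : v ≠ 0 := by simpa using hv
    obtain ⟨a, ha, hr⟩ := Points.exists_rep_mk (F := F) v hv
    exact ⟨((Units.mk0 a ha)⁻¹, Points.mk F v hv), by simp, by simp [hr, ha]⟩
  · intro a _
    exact (hh _ _ a.1.ne_zero).symm

variable [Field F] [Algebra F L]

/-- The action of `SL₂(F)` on the plane over an extension of `F`. -/
def act (g : SpecialLinearGroup (Fin 2) F) (v : Fin 2 → L) : Fin 2 → L :=
  g.1.map (algebraMap F L) *ᵥ v

theorem act_apply (g : SpecialLinearGroup (Fin 2) F) (v : Fin 2 → L) (i : Fin 2) :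
    act g v i = algebraMap F L (g.1 i 0) * v 0 + algebraMap F L (g.1 i 1) * v 1 := by
  simp [act, Matrix.mulVec, dotProduct, Fin.sum_univ_two]

theorem act_one (v : Fin 2 → L) : act (1 : SpecialLinearGroup (Fin 2) F) v = v := by
  simp [act]

theorem act_mul (g h : SpecialLinearGroup (Fin 2) F) (v : Fin 2 → L) :
    act (g * h) v = act g (act h v) := by
  rw [act, act, act, Matrix.mulVec_mulVec, ← Matrix.map_mul]
  rfl

theorem act_smul (g : SpecialLinearGroup (Fin 2) F) (c : L) (v : Fin 2 → L) :
    act g (c • v) = c • act g v := Matrix.mulVec_smul _ _ _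

theorem act_zero (g : SpecialLinearGroup (Fin 2) F) : act g (0 : Fin 2 → L) = 0 :=
  Matrix.mulVec_zero _

theorem act_inv_act (g : SpecialLinearGroup (Fin 2) F) (v : Fin 2 → L) :
    act g⁻¹ (act g v) = v := by
  rw [← act_mul, inv_mul_cancel, act_one]

theorem act_ne_zero (g : SpecialLinearGroup (Fin 2) F) {v : Fin 2 → L} (hv : v ≠ 0) :
    act g v ≠ 0 := fun h => hv (by rw [← act_inv_act g v, h, act_zero])

/-- The field `F` in `Points F L` serves only to record which group acts. -/
instance : MulAction (SpecialLinearGroup (Fin 2) F) (Points F L) where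
  smul g p := Points.mk F (act g p.rep) (act_ne_zero g p.rep_ne_zero)
  one_smul p := by
    change Points.mk F _ _ = p
    conv_rhs => rw [← p.mk_rep]
    exact Points.mk_eq_mk_iff.2 ⟨1, by rw [act_one, one_smul]⟩
  mul_smul g h p := by
    change Points.mk F _ _ = Points.mk F _ _
    obtain ⟨a, ha, hr⟩ := Points.exists_rep_mk (F := F) (act h p.rep)
      (act_ne_zero h p.rep_ne_zero)
    refine Points.mk_eq_mk_iff.2 ⟨a⁻¹, ?_⟩
    change a⁻¹ • act g (Points.mk F (act h p.rep) _).rep = _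
    rw [hr, act_smul, inv_smul_smul₀ ha, act_mul]

theorem smul_mk (g : SpecialLinearGroup (Fin 2) F) (v : Fin 2 → L) (hv : v ≠ 0) :
    g • Points.mk F v hv = Points.mk F (act g v) (act_ne_zero g hv) := by
  obtain ⟨a, ha, hr⟩ := Points.exists_rep_mk (F := F) v hv
  exact Points.mk_eq_mk_iff.2 ⟨a, by rw [hr, act_smul]⟩

theorem Points.exists_rep_smul (g : SpecialLinearGroup (Fin 2) F) (p : Points F L) :
    ∃ a : L, a ≠ 0 ∧ (g • p).rep = a • act g p.rep :=
  Points.exists_rep_mk _ _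

theorem comp_algebraMap_ne_zero {v : Fin 2 → F} (hv : v ≠ 0) :
    (fun i => algebraMap F L (v i)) ≠ 0 := fun h => hv <| funext fun i =>
  (map_eq_zero (algebraMap F L)).1 (congrFun h i)

theorem act_comp_algebraMap (g : SpecialLinearGroup (Fin 2) F) (v : Fin 2 → F) :
    act g (fun i => algebraMap F L (v i)) = fun i => algebraMap F L (act g v i) := by
  funext i
  simp [act_apply]

/-- The inclusion of the rational points. -/
def ofRational (L : Type*) [Field L] [Algebra F L] (x : Points F F) : Points F L :=
  Points.mk F (fun i => algebraMap F L (x.rep i)) (comp_algebraMap_ne_zero x.rep_ne_zero)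

theorem ofRational_mk (v : Fin 2 → F) (hv : v ≠ 0) :
    ofRational L (Points.mk F v hv) =
      Points.mk F (fun i => algebraMap F L (v i)) (comp_algebraMap_ne_zero hv) := by
  obtain ⟨a, ha, hr⟩ := Points.exists_rep_mk (F := F) v hv
  exact Points.mk_eq_mk_iff.2 ⟨algebraMap F L a, by funext i; simp [hr]⟩

theorem ofRational_smul (g : SpecialLinearGroup (Fin 2) F) (x : Points F F) :
    ofRational L (g • x) = g • ofRational L x := by
  conv_lhs => rw [← x.mk_rep, smul_mk, ofRational_mk]
  rw [ofRational, smul_mk]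
  exact Points.mk_eq_mk_iff.2 ⟨1, by rw [act_comp_algebraMap, one_smul]⟩

theorem cross_act (g : SpecialLinearGroup (Fin 2) F) (v w : Fin 2 → L) :
    cross (act g v) (act g w) = cross v w := by
  have h : algebraMap F L (g.1 0 0) * algebraMap F L (g.1 1 1)
      - algebraMap F L (g.1 0 1) * algebraMap F L (g.1 1 0) = 1 := by
    rw [← map_mul, ← map_mul, ← map_sub, ← Matrix.det_fin_two, g.2, map_one]
  simp only [cross, act_apply]
  linear_combination (v 0 * w 1 - v 1 * w 0) * h

theorem ofRational_injective : Function.Injective (ofRational (F := F) L) := fun x y h => by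
  have h1 := Points.mk_eq_mk_iff_cross.1 h
  rw [Points.eq_iff_cross, ← map_eq_zero (algebraMap F L)]
  simpa [cross] using h1

end Points

/-! ### Power sums over the projective line -/

section PowerSums

theorem cast_card_sub_one (L R : Type*) [Field L] [Fintype L] [CommRing R] [Algebra L R] :
    ((Fintype.card L - 1 : ℕ) : R) = -1 := by
  rw [Nat.cast_sub Fintype.card_pos, ← map_natCast (algebraMap L R), FiniteField.cast_card_eq_zero]
  simp

/-- The divisibility makes the monomial constant on punctured lines, and `a + b ≠ 0` makes it vanish
at the origin. The sum over the plane is then `|L| - 1 = -1` times the sum over points, and it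
factors into two power sums. -/
theorem sum_points_monomial {F L : Type*} [Field L] [Fintype L]
    {a b : ℕ} (h : Fintype.card L - 1 ∣ a + b) (h0 : a + b ≠ 0) :
    ∑ p : Points F L, p.rep 0 ^ a * p.rep 1 ^ b = -((∑ x : L, x ^ a) * ∑ x : L, x ^ b) := by
  have h1 := sum_points (F := F) (fun v : Fin 2 → L => v 0 ^ a * v 1 ^ b)
    (by
      rcases Nat.eq_zero_or_pos a with ha | ha
      · simp [show b ≠ 0 by omega]
      · simp [ha.ne'])
    (fun c v hc => by
      obtain ⟨m, hm⟩ := h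
      have hc1 : c ^ a * c ^ b = 1 := by
        rw [← pow_add, hm, pow_mul, FiniteField.pow_card_sub_one_eq_one c hc, one_pow]
      simp only [Pi.smul_apply, smul_eq_mul, mul_pow]
      linear_combination (v 0 ^ a * v 1 ^ b) * hc1)
  rw [nsmul_eq_mul, cast_card_sub_one L L, neg_one_mul] at h1
  rw [← neg_eq_iff_eq_neg, ← h1, ← (finTwoArrowEquiv L).symm.sum_comp, Fintype.sum_prod_type,
    Finset.sum_mul_sum]
  simp [finTwoArrowEquiv]

/-- One of the two exponents is below `|L| - 1`, and such power sums over `L` vanish. -/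
theorem sum_points_monomial_eq_zero {F L : Type*} [Field L] [Fintype L]
    {a b : ℕ} (h : a + b = Fintype.card L - 1) :
    ∑ p : Points F L, p.rep 0 ^ a * p.rep 1 ^ b = 0 := by
  have hL : 1 < Fintype.card L := Fintype.one_lt_card
  rw [sum_points_monomial (by rw [h]) (by omega), neg_eq_zero, mul_eq_zero]
  rcases Nat.lt_or_ge a (Fintype.card L - 1) with ha | ha
  · exact Or.inl (FiniteField.sum_pow_lt_card_sub_one L _ ha)
  · exact Or.inr (FiniteField.sum_pow_lt_card_sub_one L _ (by omega))

/-- Orthogonality of monomials of degree `|L| - 1`: unless both exponents equal `|L| - 1`, one of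
them is smaller and its power sum vanishes. -/
theorem sum_points_monomial_orthogonal {F L : Type*} [Field L] [Fintype L]
    {a b : ℕ} (h : a + b = 2 * (Fintype.card L - 1)) :
    ∑ p : Points F L, p.rep 0 ^ a * p.rep 1 ^ b = if a = Fintype.card L - 1 then -1 else 0 := by
  classical
  have hL : 1 < Fintype.card L := Fintype.one_lt_card
  rw [sum_points_monomial (by rw [h]; exact dvd_mul_left _ _) (by omega)]
  split_ifs with ha
  · have hsum : ∑ x : L, x ^ (Fintype.card L - 1) = -1 := by
      rw [← cast_card_sub_one L L, ← Finset.sum_erase_add _ _ (Finset.mem_univ (0 : L)),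
        zero_pow (by omega), add_zero, Finset.sum_congr rfl (g := fun _ => 1) (fun x hx =>
          FiniteField.pow_card_sub_one_eq_one x (Finset.ne_of_mem_erase hx))]
      simp [Finset.card_erase_of_mem]
    rw [show b = Fintype.card L - 1 by omega, ha, hsum]
    norm_num
  · rw [neg_eq_zero, mul_eq_zero]
    rcases Nat.lt_or_ge a (Fintype.card L - 1) with ha | ha
    · exact Or.inl (FiniteField.sum_pow_lt_card_sub_one L _ ha)
    · exact Or.inr (FiniteField.sum_pow_lt_card_sub_one L _ (by omega))

theorem sub_pow_card_field (F : Type*) {R : Type*} [Field F] [Fintype F] [CommRing R]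
    [Algebra F R] (a b : R) : (a - b) ^ Fintype.card F = a ^ Fintype.card F - b ^ Fintype.card F :=
  map_sub (FiniteField.frobeniusAlgHom F R) a b

theorem sum_pow_card_field (F : Type*) {R ι : Type*} [Field F] [Fintype F] [CommRing R]
    [Algebra F R] (s : Finset ι) (f : ι → R) :
    (∑ i ∈ s, f i) ^ Fintype.card F = ∑ i ∈ s, f i ^ Fintype.card F :=
  map_sum (FiniteField.frobeniusAlgHom F R) f s

/-- Divide `(a - b) ^ q = a ^ q - b ^ q` by `a - b`. For `a = b` the right side is a sum of `q`
equal terms. All signed binomial coefficients of exponent `q - 1` are thus `1`. -/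
theorem sub_pow_card_field_sub_one (F : Type*) {K : Type*} [Field F] [Fintype F] [CommRing K]
    [IsDomain K] [Algebra F K] (a b : K) :
    (a - b) ^ (Fintype.card F - 1)
      = ∑ i ∈ Finset.range (Fintype.card F), a ^ i * b ^ (Fintype.card F - 1 - i) := by
  have hF : 1 < Fintype.card F := Fintype.one_lt_card
  by_cases hab : a = b
  · subst hab
    rw [sub_self, zero_pow (by omega), Finset.sum_congr rfl (g := fun _ => a ^ (Fintype.card F - 1))
      (fun i hi => by
        rw [← pow_add]; congr 1; have := Finset.mem_range.1 hi; omega)]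
    rw [Finset.sum_const, Finset.card_range, nsmul_eq_mul, ← map_natCast (algebraMap F K),
      FiniteField.cast_card_eq_zero, map_zero, zero_mul]
  · refine mul_right_cancel₀ (sub_ne_zero.2 hab) ?_
    rw [← pow_succ, Nat.sub_add_cancel hF.le, sub_pow_card_field, geom_sum₂_mul]

theorem cross_rep_pow {F L : Type*} [Field L] [Fintype L]
    (p p' : Points F L) [Decidable (p = p')] :
    cross p.rep p'.rep ^ (Fintype.card L - 1) = if p = p' then 0 else 1 := by
  have hL : 1 < Fintype.card L := Fintype.one_lt_card
  split_ifs with h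
  · rw [Points.eq_iff_cross.1 h, zero_pow (by omega)]
  · exact FiniteField.pow_card_sub_one_eq_one _ (fun h0 => h (Points.eq_iff_cross.2 h0))

end PowerSums

/-! ### The kernel relating pairs of rational points to quadratic points -/

section Kernel

variable {F K : Type*} [Field F] [Field K] [Algebra F K]

/-- The homogeneous coordinates of a rational point in an extension field. -/
def Points.repExt (K : Type*) [Field K] [Algebra F K] (x : Points F F) : Fin 2 → K :=
  fun i => algebraMap F K (x.rep i)

theorem Points.exists_repExt_smul (g : SpecialLinearGroup (Fin 2) F) (x : Points F F) :
    ∃ a : F, a ≠ 0 ∧ (g • x).repExt K = algebraMap F K a • act g (x.repExt K) := by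
  obtain ⟨a, ha, h⟩ := x.exists_rep_smul g
  refine ⟨a, ha, funext fun i => ?_⟩
  change algebraMap F K ((g • x).rep i) = _ * act g (fun i => algebraMap F K (x.rep i)) i
  rw [h, act_comp_algebraMap]
  simp

variable [Fintype F]

theorem repExt_pow_card (x : Points F F) (i : Fin 2) :
    x.repExt K i ^ Fintype.card F = x.repExt K i := by
  rw [Points.repExt, ← map_pow, FiniteField.pow_card]

theorem cross_repExt_pow (v : Fin 2 → K) (x : Points F F) :
    cross v (x.repExt K) ^ (Fintype.card F - 1) = ∑ i ∈ Finset.range (Fintype.card F),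
      v 0 ^ i * v 1 ^ (Fintype.card F - 1 - i)
        * (x.repExt K 0 ^ (Fintype.card F - 1 - i) * x.repExt K 1 ^ i) := by
  rw [cross, sub_pow_card_field_sub_one F]
  exact Finset.sum_congr rfl fun i _ => by ring

theorem sum_repExt (a b : ℕ) : ∑ x : Points F F, x.repExt K 0 ^ a * x.repExt K 1 ^ b
    = algebraMap F K (∑ x : Points F F, x.rep 0 ^ a * x.rep 1 ^ b) := by
  simp [Points.repExt]

theorem sum_cross_repExt_pow (v : Fin 2 → K) :
    ∑ x : Points F F, cross v (x.repExt K) ^ (Fintype.card F - 1) = 0 := by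
  simp only [cross_repExt_pow]
  rw [Finset.sum_comm]
  refine Finset.sum_eq_zero fun i hi => ?_
  rw [← Finset.mul_sum, sum_repExt, sum_points_monomial_eq_zero, map_zero, mul_zero]
  have := Finset.mem_range.1 hi
  omega

/-- A reproducing formula: after expansion, orthogonality over `P(F)` keeps only the complementary
exponents `j = q - 1 - i`, and the surviving terms resum to a power of the determinant. -/
theorem sum_cross_repExt_pow_mul (v w : Fin 2 → K) :
    ∑ x : Points F F, cross v (x.repExt K) ^ (Fintype.card F - 1)
        * cross w (x.repExt K) ^ (Fintype.card F - 1)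
      = -cross v w ^ (Fintype.card F - 1) := by
  simp only [cross_repExt_pow, Finset.sum_mul_sum]
  rw [Finset.sum_comm, cross, sub_pow_card_field_sub_one F, ← Finset.sum_neg_distrib]
  refine Finset.sum_congr rfl fun i hi => ?_
  have hi := Finset.mem_range.1 hi
  rw [Finset.sum_comm, Finset.sum_eq_single_of_mem (Fintype.card F - 1 - i)
    (Finset.mem_range.2 (by omega))]
  · have h : ∀ x : Points F F, v 0 ^ i * v 1 ^ (Fintype.card F - 1 - i)
          * (x.repExt K 0 ^ (Fintype.card F - 1 - i) * x.repExt K 1 ^ i)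
          * (w 0 ^ (Fintype.card F - 1 - i) * w 1 ^ (Fintype.card F - 1 - (Fintype.card F - 1 - i))
          * (x.repExt K 0 ^ (Fintype.card F - 1 - (Fintype.card F - 1 - i))
            * x.repExt K 1 ^ (Fintype.card F - 1 - i)))
        = (v 0 * w 1) ^ i * (v 1 * w 0) ^ (Fintype.card F - 1 - i)
          * (x.repExt K 0 ^ (Fintype.card F - 1) * x.repExt K 1 ^ (Fintype.card F - 1)) := by
      intro x
      rw [show Fintype.card F - 1 - (Fintype.card F - 1 - i) = i by omega]
      obtain ⟨m, hm⟩ : ∃ m, Fintype.card F - 1 = i + m := ⟨Fintype.card F - 1 - i, by omega⟩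
      rw [hm, Nat.add_sub_cancel_left]
      ring
    rw [Finset.sum_congr rfl (fun x _ => h x), ← Finset.mul_sum, sum_repExt,
      sum_points_monomial_orthogonal (by ring), if_pos rfl]
    simp
  · intro j hj hne
    have hj := Finset.mem_range.1 hj
    have h : ∀ x : Points F F, v 0 ^ i * v 1 ^ (Fintype.card F - 1 - i)
          * (x.repExt K 0 ^ (Fintype.card F - 1 - i) * x.repExt K 1 ^ i)
          * (w 0 ^ j * w 1 ^ (Fintype.card F - 1 - j)
          * (x.repExt K 0 ^ (Fintype.card F - 1 - j) * x.repExt K 1 ^ j))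
        = v 0 ^ i * v 1 ^ (Fintype.card F - 1 - i) * (w 0 ^ j * w 1 ^ (Fintype.card F - 1 - j))
          * (x.repExt K 0 ^ (Fintype.card F - 1 - i + (Fintype.card F - 1 - j))
            * x.repExt K 1 ^ (i + j)) := fun x => by ring
    rw [Finset.sum_congr rfl (fun x _ => h x), ← Finset.mul_sum, sum_repExt,
      sum_points_monomial_orthogonal (by omega), if_neg (by omega), map_zero, mul_zero]

/-- The invariant kernel `det(w, x) ^ (q - 1) * det(w, y) ^ (q * (q - 1))` on a point `w` over the
quadratic extension and a pair `x`, `y` of rational points. -/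
def kernel (w : Points F K) (x y : Points F F) : K :=
  cross w.rep (x.repExt K) ^ (Fintype.card F - 1)
    * (cross w.rep (y.repExt K) ^ (Fintype.card F - 1)) ^ Fintype.card F

theorem sum_kernel_right (w : Points F K) (x : Points F F) :
    ∑ y, kernel w x y = 0 := by
  have hF : 1 < Fintype.card F := Fintype.one_lt_card
  simp only [kernel]
  rw [← Finset.mul_sum, ← sum_pow_card_field, sum_cross_repExt_pow, zero_pow (by omega), mul_zero]

theorem sum_kernel_left (w : Points F K) (y : Points F F) :
    ∑ x, kernel w x y = 0 := by
  simp only [kernel]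
  rw [← Finset.sum_mul, sum_cross_repExt_pow, zero_mul]

/-- Rationality of `y` absorbs the Frobenius twist on its side, while the exponent of `w` acquires
base-`q` digits `i`, `j`. This is Steinberg's tensor product theorem in coordinates. -/
theorem kernel_eq_sum (w : Points F K) (x y : Points F F) :
    kernel w x y = ∑ i ∈ Finset.range (Fintype.card F), ∑ j ∈ Finset.range (Fintype.card F),
      (x.repExt K 0 ^ (Fintype.card F - 1 - i) * x.repExt K 1 ^ i
        * (y.repExt K 0 ^ (Fintype.card F - 1 - j) * y.repExt K 1 ^ j))
      * (w.rep 0 ^ (i + Fintype.card F * j)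
        * w.rep 1 ^ (Fintype.card F - 1 - i + Fintype.card F * (Fintype.card F - 1 - j))) := by
  rw [kernel, cross_repExt_pow, cross_repExt_pow, sum_pow_card_field, Finset.sum_mul_sum]
  refine Finset.sum_congr rfl fun i _ => Finset.sum_congr rfl fun j _ => ?_
  simp only [mul_pow, ← pow_mul, mul_comm _ (Fintype.card F)]
  rw [pow_mul (y.repExt K 0), pow_mul (y.repExt K 1), repExt_pow_card, repExt_pow_card]
  ring

variable [Fintype K]

theorem card_sq_sub_one {q : ℕ} (hq : 0 < q) : q ^ 2 - 1 = (q - 1) + q * (q - 1) := by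
  obtain ⟨m, rfl⟩ : ∃ m, q = m + 1 := ⟨q - 1, by omega⟩
  rw [Nat.add_sub_cancel, pow_two, Nat.sub_eq_iff_eq_add (by nlinarith)]
  ring

theorem digits_add {q i j : ℕ} (hi : i < q) (hj : j < q) :
    i + q * j + (q - 1 - i + q * (q - 1 - j)) = q ^ 2 - 1 := by
  rw [card_sq_sub_one (by omega)]
  obtain ⟨m, hm⟩ : ∃ m, q - 1 = i + m := ⟨q - 1 - i, by omega⟩
  obtain ⟨n, hn⟩ : ∃ n, q - 1 = j + n := ⟨q - 1 - j, by omega⟩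
  rw [show q - 1 - i = m by omega, show q - 1 - j = n by omega]
  nth_rw 1 [hm]
  rw [hn]
  ring

/-- Both digits of `q ^ 2 - 1` are `q - 1`. Since `i + i' ≤ 2 * (q - 1)`, no carry can compensate
for `j + j' ≠ q - 1`. -/
theorem digits_eq_iff {q i j i' j' : ℕ} (hi : i < q) (hj : j < q) (hi' : i' < q) (hj' : j' < q) :
    i + q * j + (i' + q * j') = q ^ 2 - 1 ↔ i' = q - 1 - i ∧ j' = q - 1 - j := by
  rw [card_sq_sub_one (by omega)]
  constructor
  · intro h
    have h1 : i + i' + q * (j + j') = q - 1 + q * (q - 1) := by rw [← h]; ring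
    rcases lt_trichotomy (j + j') (q - 1) with hlt | heq | hgt
    · have : q * (j + j' + 1) ≤ q * (q - 1) := Nat.mul_le_mul_left _ hlt
      rw [mul_add] at this
      omega
    · rw [heq] at h1
      omega
    · have : q * (q - 1 + 1) ≤ q * (j + j') := Nat.mul_le_mul_left _ hgt
      rw [mul_add] at this
      omega
  · rintro ⟨rfl, rfl⟩
    obtain ⟨m, hm⟩ : ∃ m, q - 1 = i + m := ⟨q - 1 - i, by omega⟩
    obtain ⟨n, hn⟩ : ∃ n, q - 1 = j + n := ⟨q - 1 - j, by omega⟩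
    rw [show q - 1 - i = m by omega, show q - 1 - j = n by omega]
    nth_rw 1 [hm]
    rw [hn]
    ring

/-- The determinant is invariant, so only the choice of representatives matters. The kernel has
degree `q ^ 2 - 1` in `w`, and the scalars for `x` and `y` lie in `F` and occur to multiples of `q -
1`, so every scaling factor is `1`. -/
theorem kernel_smul (hK : Fintype.card K = Fintype.card F ^ 2)
    (g : SpecialLinearGroup (Fin 2) F) (w : Points F K) (x y : Points F F) :
    kernel (g • w) (g • x) (g • y) = kernel w x y := by
  obtain ⟨a, ha, hw⟩ := w.exists_rep_smul g
  obtain ⟨b, hb, hx⟩ := x.exists_repExt_smul (K := K) g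
  obtain ⟨c, hc, hy⟩ := y.exists_repExt_smul (K := K) g
  have ha1 : a ^ (Fintype.card F - 1) * (a ^ (Fintype.card F - 1)) ^ Fintype.card F = 1 := by
    rw [← pow_mul, ← pow_add, mul_comm _ (Fintype.card F), ← card_sq_sub_one Fintype.card_pos,
      ← hK, FiniteField.pow_card_sub_one_eq_one a ha]
  have hb1 : algebraMap F K b ^ (Fintype.card F - 1) = 1 := by
    rw [← map_pow, FiniteField.pow_card_sub_one_eq_one b hb, map_one]
  have hc1 : algebraMap F K c ^ (Fintype.card F - 1) = 1 := by
    rw [← map_pow, FiniteField.pow_card_sub_one_eq_one c hc, map_one]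
  simp only [kernel, hw, hx, hy, cross_smul_left, cross_smul_right, cross_act, mul_pow, hb1, hc1,
    one_mul]
  linear_combination (cross w.rep (x.repExt K) ^ (Fintype.card F - 1)
    * (cross w.rep (y.repExt K) ^ (Fintype.card F - 1)) ^ Fintype.card F) * ha1

theorem sum_kernel (hK : Fintype.card K = Fintype.card F ^ 2) (x y : Points F F) :
    ∑ w : Points F K, kernel w x y = 0 := by
  simp only [kernel_eq_sum]
  rw [Finset.sum_comm]
  refine Finset.sum_eq_zero fun i hi => ?_
  rw [Finset.sum_comm]
  refine Finset.sum_eq_zero fun j hj => ?_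
  rw [← Finset.mul_sum, sum_points_monomial_eq_zero, mul_zero]
  rw [hK, digits_add (Finset.mem_range.1 hi) (Finset.mem_range.1 hj)]

open scoped Classical in
-- The double sum is the reproducing formula times its Frobenius twist. The two signs cancel, and
-- the total exponent `(q - 1) * (1 + q)` turns the determinant into the indicator of `w ≠ w'`.
theorem sum_kernel_mul_kernel_rational (hK : Fintype.card K = Fintype.card F ^ 2)
    (w w' : Points F K) :
    ∑ x, ∑ y, kernel w x y * kernel w' x y = if w = w' then 0 else 1 := by
  have h : ∀ x y, kernel w x y * kernel w' x y
      = (cross w.rep (x.repExt K) ^ (Fintype.card F - 1)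
          * cross w'.rep (x.repExt K) ^ (Fintype.card F - 1))
        * (cross w.rep (y.repExt K) ^ (Fintype.card F - 1)
          * cross w'.rep (y.repExt K) ^ (Fintype.card F - 1)) ^ Fintype.card F := by
    intro x y
    simp only [kernel, mul_pow]
    ring
  have hneg : ∀ c : K, (-c) ^ Fintype.card F = -c ^ Fintype.card F :=
    fun c => map_neg (FiniteField.frobeniusAlgHom F K) c
  simp only [h]
  rw [← Finset.sum_mul_sum, ← sum_pow_card_field, sum_cross_repExt_pow_mul, hneg, neg_mul_neg,
    ← pow_mul, ← pow_add, mul_comm _ (Fintype.card F), ← card_sq_sub_one Fintype.card_pos, ← hK,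
    cross_rep_pow]

/-- Expand both kernels by pairs of digits. Orthogonality over `P(K)` pairs each digit pair with its
complement, and what remains is the product of the expansions of two rational determinants. -/
theorem sum_kernel_mul_kernel_points (hK : Fintype.card K = Fintype.card F ^ 2)
    (x y x' y' : Points F F) [Decidable (x = x')] [Decidable (y = y')] :
    ∑ w : Points F K, kernel w x y * kernel w x' y'
      = -((if x = x' then 0 else 1) * (if y = y' then 0 else 1)) := by
  -- The arguments are swapped to match the order of exponents in the expansion; the sign is
  -- harmless because `(-1) ^ (q - 1) = 1` in `F`.
  have hcross : ∀ x x' : Points F F, ∀ [Decidable (x = x')],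
      (if x = x' then (0 : K) else 1) = cross (x'.repExt K) (x.repExt K) ^ (Fintype.card F - 1) := by
    intro x x' _
    have h1 : cross (x'.repExt K) (x.repExt K) = algebraMap F K (-cross x.rep x'.rep) := by
      simp only [cross, Points.repExt, map_neg, map_sub, map_mul]; ring
    have h2 : (-cross x.rep x'.rep) ^ (Fintype.card F - 1)
        = cross x.rep x'.rep ^ (Fintype.card F - 1) := by
      have h3 : (-1 : F) ^ (Fintype.card F - 1) = 1 :=
        FiniteField.pow_card_sub_one_eq_one _ (by simp)
      rw [neg_pow, h3, one_mul]
    rw [h1, ← map_pow, h2, cross_rep_pow]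
    split_ifs <;> simp
  let S := Finset.range (Fintype.card F) ×ˢ Finset.range (Fintype.card F)
  let A : Points F F → Points F F → ℕ × ℕ → K := fun x y p =>
    x.repExt K 0 ^ (Fintype.card F - 1 - p.1) * x.repExt K 1 ^ p.1
      * (y.repExt K 0 ^ (Fintype.card F - 1 - p.2) * y.repExt K 1 ^ p.2)
  let M : Points F K → ℕ × ℕ → K := fun w p => w.rep 0 ^ (p.1 + Fintype.card F * p.2)
    * w.rep 1 ^ (Fintype.card F - 1 - p.1 + Fintype.card F * (Fintype.card F - 1 - p.2))
  have hkernel : ∀ w x y, kernel w x y = ∑ p ∈ S, A x y p * M w p := fun w x y => by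
    rw [kernel_eq_sum, Finset.sum_product]
  have hM : ∀ p ∈ S, ∀ p' ∈ S, ∑ w, M w p * M w p'
      = if p' = (Fintype.card F - 1 - p.1, Fintype.card F - 1 - p.2) then -1 else 0 := by
    intro p hp p' hp'
    simp only [S, Finset.mem_product, Finset.mem_range] at hp hp'
    have h1 : ∀ w, M w p * M w p' = w.rep 0 ^ (p.1 + Fintype.card F * p.2
          + (p'.1 + Fintype.card F * p'.2))
        * w.rep 1 ^ (Fintype.card F - 1 - p.1 + Fintype.card F * (Fintype.card F - 1 - p.2)
          + (Fintype.card F - 1 - p'.1 + Fintype.card F * (Fintype.card F - 1 - p'.2))) :=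
      fun w => by simp only [M]; ring
    have h2 := digits_add hp.1 hp.2
    have h3 := digits_add hp'.1 hp'.2
    rw [Finset.sum_congr rfl fun w _ => h1 w, sum_points_monomial_orthogonal (by omega)]
    simp only [hK, digits_eq_iff hp.1 hp.2 hp'.1 hp'.2, Prod.ext_iff]
  simp only [hkernel, Finset.sum_mul_sum]
  have hR : (if x = x' then (0 : K) else 1) * (if y = y' then 0 else 1)
      = ∑ p ∈ S, A x y p * A x' y' (Fintype.card F - 1 - p.1, Fintype.card F - 1 - p.2) := by
    rw [hcross x x', hcross y y', cross_repExt_pow, cross_repExt_pow, Finset.sum_mul_sum,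
      ← Finset.sum_product']
    refine Finset.sum_congr rfl fun p hp => ?_
    simp only [S, Finset.mem_product, Finset.mem_range] at hp
    simp only [A]
    rw [show Fintype.card F - 1 - (Fintype.card F - 1 - p.1) = p.1 by omega,
      show Fintype.card F - 1 - (Fintype.card F - 1 - p.2) = p.2 by omega]
    ring
  rw [Finset.sum_comm, hR, ← Finset.sum_neg_distrib]
  refine Finset.sum_congr rfl fun p hp => ?_
  have hp' : (Fintype.card F - 1 - p.1, Fintype.card F - 1 - p.2) ∈ S := by
    simp only [S, Finset.mem_product, Finset.mem_range] at hp ⊢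
    omega
  have h4 : ∀ p' ∈ S, ∑ w, A x y p * M w p * (A x' y' p' * M w p')
      = if p' = (Fintype.card F - 1 - p.1, Fintype.card F - 1 - p.2)
        then -(A x y p * A x' y' p') else 0 := by
    intro p' hp'
    have h5 : ∀ w, A x y p * M w p * (A x' y' p' * M w p')
        = A x y p * A x' y' p' * (M w p * M w p') := fun w => mul_mul_mul_comm _ _ _ _
    rw [Finset.sum_congr rfl fun w _ => h5 w, ← Finset.mul_sum, hM p hp p' hp']
    split_ifs <;> simp
  rw [Finset.sum_comm (s := Finset.univ)]
  refine (Finset.sum_congr rfl h4).trans ?_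
  rw [Finset.sum_ite_eq', if_pos hp']

end Kernel

/-! ### Equivariant maps with vanishing sums -/

section SumZero

variable {k G W X Y : Type*} [Field k] [Group G] [AddCommGroup W] [Module k W]
  [MulAction G X]

/-- The sum of the values of a map on a finite type. -/
def sumMap (k W X : Type*) [Field k] [AddCommGroup W] [Module k W] [Fintype X] :
    (X → W) →ₗ[k] W := ∑ x, LinearMap.proj x

@[simp]
theorem sumMap_apply [Fintype X] (f : X → W) : sumMap k W X f = ∑ x, f x := by
  simp [sumMap]

/-- The partial sums of a map on a product over the second variable. -/
def sumRight (k W X Y : Type*) [Field k] [AddCommGroup W] [Module k W] [Fintype Y] :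
    (X × Y → W) →ₗ[k] (X → W) := LinearMap.pi fun x => ∑ y, LinearMap.proj (x, y)

@[simp]
theorem sumRight_apply [Fintype Y] (f : X × Y → W) (x : X) : sumRight k W X Y f x = ∑ y, f (x, y) := by
  simp [sumRight]

/-- The partial sums of a map on a product over the first variable. -/
def sumLeft (k W X Y : Type*) [Field k] [AddCommGroup W] [Module k W] [Fintype X] :
    (X × Y → W) →ₗ[k] (Y → W) := LinearMap.pi fun y => ∑ x, LinearMap.proj (x, y)

@[simp]
theorem sumLeft_apply [Fintype X] (f : X × Y → W) (y : Y) : sumLeft k W X Y f y = ∑ x, f (x, y) := by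
  simp [sumLeft]

variable [Fintype X]

/-- The equivariant maps whose values sum to zero. -/
def sumZeroMaps (ρ : Representation k G W) (X : Type*) [MulAction G X] [Fintype X] :
    Submodule k (X → W) := equivariantMaps ρ X ⊓ LinearMap.ker (sumMap k W X)

theorem mem_sumZeroMaps {ρ : Representation k G W} {f : X → W} :
    f ∈ sumZeroMaps ρ X ↔ f ∈ equivariantMaps ρ X ∧ ∑ x, f x = 0 := by
  simp [sumZeroMaps]

/-- The equivariant maps on pairs all of whose partial sums in either variable are zero. -/
def doublySumZeroMaps (ρ : Representation k G W) (X : Type*) [MulAction G X] [Fintype X] :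
    Submodule k (X × X → W) :=
  equivariantMaps ρ (X × X) ⊓ LinearMap.ker (sumRight k W X X) ⊓ LinearMap.ker (sumLeft k W X X)

theorem mem_doublySumZeroMaps {ρ : Representation k G W} {f : X × X → W} :
    f ∈ doublySumZeroMaps ρ X ↔ f ∈ equivariantMaps ρ (X × X)
      ∧ (∀ x, ∑ y, f (x, y) = 0) ∧ ∀ y, ∑ x, f (x, y) = 0 := by
  simp [doublySumZeroMaps, funext_iff, and_assoc]

theorem sum_smul_point {M : Type*} [AddCommMonoid M] (g : G) (f : X → M) :
    ∑ x, f (g • x) = ∑ x, f x := Equiv.sum_comp (MulAction.toPerm g) f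

variable [Module.Finite k W]

/-- Since `|X| = 1` in `k`, constant maps with fixed value give a section of summation. -/
theorem finrank_equivariantMaps (ρ : Representation k G W)
    (hX : (Fintype.card X : k) = 1) :
    finrank k (equivariantMaps ρ X)
      = finrank k (fixedVectors ρ ⊤) + finrank k (sumZeroMaps ρ X) := by
  refine finrank_eq_add_finrank_inf_ker (sumMap k W X) (fun w _ => w) ?_ ?_ ?_
  · intro f hf g _
    rw [sumMap_apply, map_sum]
    exact (Finset.sum_congr rfl fun x _ => (hf g x).symm).trans (sum_smul_point g f)
  · exact fun w hw g x => (hw g trivial).symm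
  · intro w _
    rw [sumMap_apply, Finset.sum_const, Finset.card_univ, ← Nat.cast_smul_eq_nsmul k, hX, one_smul]

/-- Row sums map onto all equivariant maps on `X`. On their kernel, column sums have total zero and
map onto the maps with zero sum. Pulling back along a projection gives a section in both cases, as
`|X| = 1` in `k`. -/
theorem finrank_equivariantMaps_prod (ρ : Representation k G W)
    (hX : (Fintype.card X : k) = 1) :
    finrank k (equivariantMaps ρ (X × X)) = finrank k (equivariantMaps ρ X)
      + (finrank k (sumZeroMaps ρ X) + finrank k (doublySumZeroMaps ρ X)) := by
  rw [finrank_eq_add_finrank_inf_ker (T := equivariantMaps ρ X) (sumRight k W X X)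
    (fun h p => h p.1)]
  · congr 1
    refine finrank_eq_add_finrank_inf_ker (sumLeft k W X X) (fun h p => h p.2) ?_ ?_ ?_
    · rintro f ⟨hf, hf0⟩
      refine mem_sumZeroMaps.2 ⟨fun g y => ?_, ?_⟩
      · simp only [sumLeft_apply]
        rw [map_sum, ← sum_smul_point g]
        exact Finset.sum_congr rfl fun x _ => hf g (x, y)
      · simp only [sumLeft_apply]
        rw [Finset.sum_comm]
        refine Finset.sum_eq_zero fun x _ => ?_
        have h := congrFun (LinearMap.mem_ker.1 hf0) x
        rwa [sumRight_apply] at h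
    · intro h hh
      obtain ⟨hh, hh0⟩ := mem_sumZeroMaps.1 hh
      refine ⟨fun g p => hh g p.2, LinearMap.mem_ker.2 (funext fun x => ?_)⟩
      rw [sumRight_apply]
      exact hh0
    · intro h _
      funext y
      simp only [sumLeft_apply]
      rw [Finset.sum_const, Finset.card_univ, ← Nat.cast_smul_eq_nsmul k, hX,
        one_smul]
  · intro f hf g x
    simp only [sumRight_apply]
    rw [map_sum, ← sum_smul_point g]
    exact Finset.sum_congr rfl fun y _ => hf g (x, y)
  · exact fun h hh g p => hh g p.1
  · intro h _
    funext y
    simp only [sumRight_apply]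
    rw [Finset.sum_const, Finset.card_univ, ← Nat.cast_smul_eq_nsmul k, hX,
      one_smul]

open scoped Classical in
/-- If the complement of an invariant copy of `Y` in `X` is a single orbit, then the equivariant
maps on `X` are made up of those on `Y` and of the vectors fixed by a stabilizer. -/
theorem finrank_equivariantMaps_eq_add {Y : Type*} [MulAction G Y] (ρ : Representation k G W)
    (i : Y → X) (hi : Function.Injective i) (hsmul : ∀ (g : G) (y : Y), i (g • y) = g • i y) (z : X)
    (hz : z ∉ Set.range i) (hX : ∀ x ∉ Set.range i, x ∈ MulAction.orbit G z) :
    finrank k (equivariantMaps ρ X)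
      = finrank k (equivariantMaps ρ Y)
        + finrank k (fixedVectors ρ (MulAction.stabilizer G z)) := by
  have hrange : ∀ (g : G) (x : X), g • x ∈ Set.range i ↔ x ∈ Set.range i := by
    have h : ∀ (g : G) (x : X), x ∈ Set.range i → g • x ∈ Set.range i := by
      rintro g _ ⟨y, rfl⟩
      exact ⟨g • y, hsmul g y⟩
    refine fun g x => ⟨fun hx => ?_, h g x⟩
    rw [← inv_smul_smul g x]
    exact h _ _ hx
  have horbit : ∀ x, x ∈ MulAction.orbit G z ↔ x ∉ Set.range i := by
    refine fun x => ⟨?_, hX x⟩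
    rintro ⟨g, rfl⟩
    simpa only [hrange] using hz
  -- Restriction along `i` has extension by zero as a section, and its kernel consists of the maps
  -- supported on the remaining orbit.
  rw [finrank_eq_add_finrank_inf_ker (T := equivariantMaps ρ Y) (LinearMap.funLeft k W i)
    (fun h x => if hx : x ∈ Set.range i then h hx.choose else 0), ← finrank_equivariantMaps_orbit]
  · have hker : LinearMap.ker (LinearMap.funLeft k W i)
        = supportedMaps k W (MulAction.orbit G z) := by
      ext f
      rw [mem_supportedMaps, LinearMap.mem_ker, funext_iff]
      simp only [horbit, not_not, LinearMap.funLeft_apply]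
      exact ⟨fun h => by rintro _ ⟨y, rfl⟩; exact h y, fun h y => h _ ⟨y, rfl⟩⟩
    rw [hker]
  · intro f hf g y
    rw [LinearMap.funLeft_apply, hsmul, hf, LinearMap.funLeft_apply]
  · intro h hh g x
    by_cases hx : x ∈ Set.range i
    · have hgx : g • x ∈ Set.range i := (hrange g x).2 hx
      have h1 : hgx.choose = g • hx.choose :=
        hi (by rw [hgx.choose_spec, hsmul, hx.choose_spec])
      simp only [dif_pos hx, dif_pos hgx]
      rw [h1, hh]
    · simp only [dif_neg hx, dif_neg (fun h => hx ((hrange g x).1 h)), map_zero]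
  · intro h _
    funext y
    have hy : i y ∈ Set.range i := ⟨y, rfl⟩
    rw [LinearMap.funLeft_apply, dif_pos hy, hi hy.choose_spec]

end SumZero

/-! ### The integral transform and the resulting dimension identity -/

section Transform

variable {F K k W : Type*} [Field F] [Fintype F] [Field K] [Algebra F K]
  [Field k] [Algebra K k] [AddCommGroup W] [Module k W]

theorem sum_ite_smul {X : Type*} [Fintype X] [DecidableEq X] (f : X → W) (x : X) :
    ∑ y, (if x = y then (0 : k) else 1) • f y = ∑ y, f y - f x := by
  rw [eq_sub_iff_add_eq, ← Finset.sum_erase_add _ (fun y => (if x = y then (0 : k) else 1) • f y) (Finset.mem_univ x), if_pos rfl, zero_smul,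
    add_zero, ← Finset.sum_erase_add _ f (Finset.mem_univ x)]
  congr 1
  exact Finset.sum_congr rfl fun y hy => by rw [if_neg (Finset.ne_of_mem_erase hy).symm, one_smul]

/-- The integral transform, with respect to the kernel, from maps on pairs of rational points to
maps on quadratic points. -/
def transform (F K k W : Type*) [Field F] [Fintype F] [Field K] [Algebra F K]
    [Field k] [Algebra K k] [AddCommGroup W] [Module k W] :
    (Points F F × Points F F → W) →ₗ[k] (Points F K → W) :=
  LinearMap.pi fun w => ∑ p, algebraMap K k (kernel w p.1 p.2) • LinearMap.proj p

theorem transform_apply (f : Points F F × Points F F → W) (w : Points F K) :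
    transform F K k W f w = ∑ p, algebraMap K k (kernel w p.1 p.2) • f p := by
  simp [transform]

variable [Fintype K]

/-- The transform and minus its transpose are inverse to each other. Their composites have matrices
built from `1 - δ`, which acts as `-1` on maps with zero sum. -/
theorem finrank_doublySumZeroMaps (hK : Fintype.card K = Fintype.card F ^ 2)
    (ρ : Representation k (SpecialLinearGroup (Fin 2) F) W) :
    finrank k (doublySumZeroMaps ρ (Points F F)) = finrank k (sumZeroMaps ρ (Points F K)) := by
  classical
  refine finrank_eq_of_inverse (transform F K k W)
    -- The sign cancels the single factor `1 - δ` arising on `P(K)`. On pairs there are two such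
    -- factors, and the sign of `sum_kernel_mul_kernel_points` does the cancelling.
    (fun f p => -∑ w, algebraMap K k (kernel w p.1 p.2) • f w) ?_ ?_ ?_ ?_
  · intro f hf
    obtain ⟨hf, -, -⟩ := mem_doublySumZeroMaps.1 hf
    refine mem_sumZeroMaps.2 ⟨fun g w => ?_, ?_⟩
    · rw [transform_apply, transform_apply, map_sum, ← sum_smul_point g]
      refine Finset.sum_congr rfl fun p _ => ?_
      rw [hf, map_smul, Prod.smul_fst, Prod.smul_snd, kernel_smul hK]
    · simp only [transform_apply]
      rw [Finset.sum_comm]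
      refine Finset.sum_eq_zero fun p _ => ?_
      rw [← Finset.sum_smul, ← map_sum, sum_kernel hK, map_zero, zero_smul]
  · intro f hf
    obtain ⟨hf, -⟩ := mem_sumZeroMaps.1 hf
    refine mem_doublySumZeroMaps.2 ⟨fun g p => ?_, fun x => ?_, fun y => ?_⟩
    · simp only
      rw [map_neg, map_sum, ← sum_smul_point g]
      congr 1
      refine Finset.sum_congr rfl fun w _ => ?_
      rw [hf, map_smul, Prod.smul_fst, Prod.smul_snd, kernel_smul hK]
    · simp only
      rw [Finset.sum_neg_distrib, Finset.sum_comm, neg_eq_zero]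
      refine Finset.sum_eq_zero fun w _ => ?_
      rw [← Finset.sum_smul, ← map_sum, sum_kernel_right, map_zero, zero_smul]
    · simp only
      rw [Finset.sum_neg_distrib, Finset.sum_comm, neg_eq_zero]
      refine Finset.sum_eq_zero fun w _ => ?_
      rw [← Finset.sum_smul, ← map_sum, sum_kernel_left, map_zero, zero_smul]
  · intro f hf
    obtain ⟨-, hf0⟩ := mem_sumZeroMaps.1 hf
    funext w
    rw [transform_apply]
    simp only [smul_neg, Finset.smul_sum, smul_smul, ← map_mul]
    rw [Finset.sum_neg_distrib, Finset.sum_comm, neg_eq_iff_eq_neg]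
    have h : ∀ w' : Points F K, ∑ p : Points F F × Points F F,
        algebraMap K k (kernel w p.1 p.2 * kernel w' p.1 p.2) • f w'
          = (if w = w' then (0 : k) else 1) • f w' := fun w' => by
      rw [← Finset.sum_smul, ← map_sum, Fintype.sum_prod_type, sum_kernel_mul_kernel_rational hK]
      split_ifs <;> simp
    rw [Finset.sum_congr rfl fun w' _ => h w', sum_ite_smul, hf0, zero_sub]
  · intro f hf
    obtain ⟨-, hf1, hf2⟩ := mem_doublySumZeroMaps.1 hf
    funext ⟨x, y⟩
    simp only [transform_apply, Finset.smul_sum, smul_smul, ← map_mul]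
    rw [Finset.sum_comm]
    have h : ∀ p : Points F F × Points F F, ∑ w : Points F K,
        algebraMap K k (kernel w x y * kernel w p.1 p.2) • f p
          = -((if x = p.1 then (0 : k) else 1) • (if y = p.2 then (0 : k) else 1) • f p) := by
      intro p
      rw [← Finset.sum_smul, ← map_sum, sum_kernel_mul_kernel_points hK, smul_smul, ← neg_smul]
      congr 1
      split_ifs <;> simp
    rw [Finset.sum_congr rfl fun p _ => h p, Finset.sum_neg_distrib, neg_neg,
      Fintype.sum_prod_type]
    have h1 : ∀ a, ∑ b, (if x = a then (0 : k) else 1) • (if y = b then (0 : k) else 1) • f (a, b)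
        = -((if x = a then (0 : k) else 1) • f (a, y)) := fun a => by
      rw [← Finset.smul_sum, sum_ite_smul (fun b => f (a, b)), hf1, zero_sub, smul_neg]
    rw [Finset.sum_congr rfl fun a _ => h1 a, Finset.sum_neg_distrib,
      sum_ite_smul (fun a => f (a, y)), hf2, zero_sub, neg_neg]

/-- Equivariant maps on `P(F) × P(F)` and on `P(K)` are each counted once by orbits and once by
partial sums. Equating the counts and using `finrank_doublySumZeroMaps` eliminates every other
dimension. -/
theorem finrank_fixedVectors_split [Module.Finite k W] [Algebra F k]
    (hK : Fintype.card K = Fintype.card F ^ 2)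
    (ρ : Representation k (SpecialLinearGroup (Fin 2) F) W) (z : Points F F × Points F F)
    (hz : z.1 ≠ z.2) (hz' : ∀ p : Points F F × Points F F, p.1 ≠ p.2 →
      p ∈ MulAction.orbit (SpecialLinearGroup (Fin 2) F) z)
    (y : Points F K) (hy : y ∉ Set.range (ofRational (F := F) K))
    (hy' : ∀ p ∉ Set.range (ofRational (F := F) K),
      p ∈ MulAction.orbit (SpecialLinearGroup (Fin 2) F) y) :
    finrank k (fixedVectors ρ (MulAction.stabilizer _ z))
      = finrank k (fixedVectors ρ (MulAction.stabilizer _ y))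
        + 2 * finrank k (sumZeroMaps ρ (Points F F)) := by
  have hF : (Fintype.card (Points F F) : k) = 1 := by
    rw [card_points, Nat.cast_add, ← map_natCast (algebraMap F k), FiniteField.cast_card_eq_zero]
    simp
  have hK' : (Fintype.card (Points F K) : k) = 1 := by
    rw [card_points, Nat.cast_add, ← map_natCast (algebraMap K k), FiniteField.cast_card_eq_zero]
    simp
  have h1 := finrank_equivariantMaps ρ hF
  have h2 := finrank_equivariantMaps ρ hK'
  have h3 := finrank_equivariantMaps_prod ρ hF
  have h4 := finrank_equivariantMaps_eq_add ρ (fun x : Points F F => (x, x))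
    (fun x y h => (Prod.ext_iff.1 h).1) (fun g x => rfl) z
    (by rintro ⟨x, rfl⟩; exact hz rfl)
    (fun p hp => hz' p fun h => hp ⟨p.1, Prod.ext rfl h⟩)
  have h5 := finrank_equivariantMaps_eq_add ρ (ofRational K) ofRational_injective
    ofRational_smul y hy hy'
  have h6 := finrank_doublySumZeroMaps hK ρ
  omega

end Transform

/-! ### Homomorphisms from the Steinberg module -/

section Steinberg

variable {F : Type*} [Field F]

/-- The linear form with given coefficients. -/
def linearForm (v : Fin 2 → F) : MvPolynomial (Fin 2) F :=
  v 0 • MvPolynomial.X 0 + v 1 • MvPolynomial.X 1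

theorem linearForm_smul (a : F) (v : Fin 2 → F) : linearForm (a • v) = a • linearForm v := by
  simp [linearForm, mul_smul]

theorem polyRep_linearForm_pow (g : SpecialLinearGroup (Fin 2) F) (v : Fin 2 → F) (n : ℕ) :
    polyRep F g (linearForm v ^ n) = linearForm (act g v) ^ n := by
  change MvPolynomial.aeval _ (linearForm v ^ n) = _
  rw [map_pow]
  congr 1
  simp only [linearForm, map_add, map_smul, MvPolynomial.aeval_X, act_apply, Algebra.algebraMap_self,
    RingHom.id_apply]
  module

theorem linearForm_pow_mem (v : Fin 2 → F) (n : ℕ) : linearForm v ^ n ∈ simpleSubmodule F n := by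
  rw [linearForm, add_pow]
  refine Submodule.sum_mem _ fun m hm => ?_
  have h : (v 0 • MvPolynomial.X 0 : MvPolynomial (Fin 2) F) ^ m
        * (v 1 • MvPolynomial.X 1) ^ (n - m)
          * ((n.choose m : ℕ) : MvPolynomial (Fin 2) F)
      = (v 0 ^ m * v 1 ^ (n - m)) • (((n.choose m : ℕ) : F) •
          (MvPolynomial.X 0 ^ m * MvPolynomial.X 1 ^ (n - m))) := by
    simp only [MvPolynomial.smul_eq_C_mul, map_natCast, map_mul, map_pow, mul_pow]
    ring
  rw [h]
  exact Submodule.smul_mem _ _ (choose_smul_mem F n m (Nat.lt_succ_iff.1 (Finset.mem_range.1 hm)))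

/-- The evaluation of polynomials at the point orthogonal to a given point. -/
def evalOrth (x : Points F F) : MvPolynomial (Fin 2) F →ₗ[F] F :=
  (MvPolynomial.aeval ![x.rep 1, -x.rep 0]).toLinearMap

theorem evalOrth_monomial (x : Points F F) (i j : ℕ) :
    evalOrth x (MvPolynomial.X 0 ^ i * MvPolynomial.X 1 ^ j) = x.rep 1 ^ i * (-x.rep 0) ^ j := by
  simp [evalOrth]

theorem evalOrth_linearForm_pow (x : Points F F) (v : Fin 2 → F) (n : ℕ) :
    evalOrth x (linearForm v ^ n) = cross v x.rep ^ n := by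
  simp only [evalOrth, linearForm, AlgHom.toLinearMap_apply, map_pow, map_add, map_smul,
    MvPolynomial.aeval_X, cross]
  congr 1
  simp
  ring

variable [Fintype F]

theorem linearForm_pow_card_sub_one (v : Fin 2 → F) :
    linearForm v ^ (Fintype.card F - 1) = ∑ i ∈ Finset.range (Fintype.card F),
      (v 0 ^ i * (-v 1) ^ (Fintype.card F - 1 - i)) •
        (MvPolynomial.X 0 ^ i * MvPolynomial.X 1 ^ (Fintype.card F - 1 - i)) := by
  have h : linearForm v = v 0 • MvPolynomial.X 0 - (-v 1) • MvPolynomial.X 1 := by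
    rw [linearForm, neg_smul, sub_neg_eq_add]
  rw [h, sub_pow_card_field_sub_one F]
  refine Finset.sum_congr rfl fun i _ => ?_
  rw [smul_pow, smul_pow, smul_mul_smul_comm]

theorem sum_linearForm_pow :
    ∑ x : Points F F, linearForm x.rep ^ (Fintype.card F - 1) = 0 := by
  simp only [linearForm_pow_card_sub_one]
  rw [Finset.sum_comm]
  refine Finset.sum_eq_zero fun i hi => ?_
  have hi := Finset.mem_range.1 hi
  rw [← Finset.sum_smul]
  have h : ∀ x : Points F F, x.rep 0 ^ i * (-x.rep 1) ^ (Fintype.card F - 1 - i)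
      = (-1) ^ (Fintype.card F - 1 - i) * (x.rep 0 ^ i * x.rep 1 ^ (Fintype.card F - 1 - i)) :=
    fun x => by rw [neg_pow]; ring
  rw [Finset.sum_congr rfl fun x _ => h x, ← Finset.mul_sum,
    sum_points_monomial_eq_zero (by omega), mul_zero, zero_smul]

/-- An explicit reconstruction of `s` from its values at rational points, which shows that the
powers of linear forms span. On a monomial it reduces to orthogonality. -/
theorem sum_evalOrth_smul_linearForm_pow {s : MvPolynomial (Fin 2) F}
    (hs : s ∈ simpleSubmodule F (Fintype.card F - 1)) :
    ∑ x, evalOrth x s • linearForm x.rep ^ (Fintype.card F - 1) = -s := by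
  induction hs using Submodule.span_induction with
  | zero => simp
  | add s t _ _ hs ht => simp only [map_add, add_smul, Finset.sum_add_distrib, hs, ht, neg_add]
  | smul c s _ hs =>
    simp only [map_smul, smul_assoc, ← Finset.smul_sum, hs, smul_neg]
  | mem s hs =>
    obtain ⟨i, hi, -, rfl⟩ := hs
    have hcard : 1 < Fintype.card F := Fintype.one_lt_card
    simp only [evalOrth_monomial, linearForm_pow_card_sub_one, Finset.smul_sum, smul_smul]
    rw [Finset.sum_comm, Finset.sum_eq_single_of_mem i (Finset.mem_range.2 (by omega))]
    · rw [← Finset.sum_smul]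
      have h : ∀ x : Points F F, x.rep 1 ^ i * (-x.rep 0) ^ (Fintype.card F - 1 - i)
            * (x.rep 0 ^ i * (-x.rep 1) ^ (Fintype.card F - 1 - i))
          = x.rep 0 ^ (Fintype.card F - 1) * x.rep 1 ^ (Fintype.card F - 1) := by
        intro x
        obtain ⟨m, hm⟩ : ∃ m, Fintype.card F - 1 = i + m := ⟨Fintype.card F - 1 - i, by omega⟩
        rw [hm, Nat.add_sub_cancel_left, neg_pow (x.rep 0), neg_pow (x.rep 1)]
        have h1 : (-1 : F) ^ m * (-1) ^ m = 1 := by rw [← mul_pow]; simp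
        linear_combination (x.rep 1 ^ i * x.rep 0 ^ m * x.rep 0 ^ i * x.rep 1 ^ m) * h1
      rw [Finset.sum_congr rfl fun x _ => h x, sum_points_monomial_orthogonal (by ring),
        if_pos rfl, neg_one_smul]
    · intro j hj hne
      have hj := Finset.mem_range.1 hj
      rw [← Finset.sum_smul]
      have h : ∀ x : Points F F, x.rep 1 ^ i * (-x.rep 0) ^ (Fintype.card F - 1 - i)
            * (x.rep 0 ^ j * (-x.rep 1) ^ (Fintype.card F - 1 - j))
          = (-1) ^ (Fintype.card F - 1 - i) * (-1) ^ (Fintype.card F - 1 - j)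
            * (x.rep 0 ^ (Fintype.card F - 1 - i + j)
              * x.rep 1 ^ (i + (Fintype.card F - 1 - j))) := by
        intro x
        rw [neg_pow (x.rep 0), neg_pow (x.rep 1)]
        ring
      rw [Finset.sum_congr rfl fun x _ => h x, ← Finset.mul_sum,
        sum_points_monomial_orthogonal (by omega), if_neg (by omega), mul_zero, zero_smul]

/-- The vector of the Steinberg module attached to a rational point. -/
def pointVector (x : Points F F) : simpleSubmodule F (Fintype.card F - 1) :=
  ⟨linearForm x.rep ^ (Fintype.card F - 1), linearForm_pow_mem _ _⟩

/-- A change of representative by `a` multiplies the vector by `a ^ (q - 1) = 1`. -/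
theorem steinberg_pointVector (g : SpecialLinearGroup (Fin 2) F) (x : Points F F) :
    steinberg F g (pointVector x) = pointVector (g • x) := by
  refine Subtype.ext ?_
  obtain ⟨a, ha, h⟩ := x.exists_rep_smul g
  have h1 : (steinberg F g (pointVector x) : MvPolynomial (Fin 2) F)
      = polyRep F g (linearForm x.rep ^ (Fintype.card F - 1)) := rfl
  have h2 : (pointVector (g • x) : MvPolynomial (Fin 2) F)
      = linearForm (g • x).rep ^ (Fintype.card F - 1) := rfl
  rw [h1, h2, polyRep_linearForm_pow, h, linearForm_smul, smul_pow,
    FiniteField.pow_card_sub_one_eq_one a ha, one_smul]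

theorem sum_evalOrth_smul_pointVector (s : simpleSubmodule F (Fintype.card F - 1)) :
    ∑ x, evalOrth x (s : MvPolynomial (Fin 2) F) • pointVector x = -s := by
  refine Subtype.ext ?_
  rw [Submodule.coe_neg, ← sum_evalOrth_smul_linearForm_pow s.2]
  simp [pointVector]

variable {V : Type*} [AddCommGroup V] [Module F V]

/-- The restriction of a homomorphism from the Steinberg module to the vectors attached to
points. -/
def restrictPoints (ρ : Representation F (SpecialLinearGroup (Fin 2) F) V) :
    Representation.IntertwiningMap (steinberg F) ρ →ₗ[F] sumZeroMaps ρ (Points F F) where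
  toFun φ := ⟨fun x => φ.toLinearMap (pointVector x), mem_sumZeroMaps.2
    ⟨fun g x => by
      change φ.toLinearMap (pointVector (g • x)) = ρ g (φ.toLinearMap (pointVector x))
      rw [← steinberg_pointVector]
      exact LinearMap.congr_fun (φ.isIntertwining' g) _, by
      have h : ∑ x : Points F F, pointVector x = 0 := Subtype.ext (by
        simpa [pointVector] using sum_linearForm_pow (F := F))
      rw [← map_sum, h, map_zero]⟩⟩
  map_add' φ ψ := rfl
  map_smul' c φ := rfl

/-- Injectivity: the point vectors span. Surjectivity: the reconstruction formula dictates the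
candidate `φ`, which takes the value `f x` at the vector of `x` because the evaluations there are `1
- δ` and `f` has sum zero. -/
theorem restrictPoints_bijective (ρ : Representation F (SpecialLinearGroup (Fin 2) F) V) :
    Function.Bijective (restrictPoints ρ) := by
  classical
  constructor
  · intro φ ψ h
    refine Representation.IntertwiningMap.ext (LinearMap.ext fun s => ?_)
    have h1 : ∀ x, φ.toLinearMap (pointVector x) = ψ.toLinearMap (pointVector x) :=
      fun x => congrFun (congrArg Subtype.val h) x
    rw [← neg_inj, ← map_neg, ← map_neg, ← sum_evalOrth_smul_pointVector]
    simp only [map_sum, map_smul, h1]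
  · rintro ⟨f, hf⟩
    obtain ⟨hf, hf0⟩ := mem_sumZeroMaps.1 hf
    let φ : simpleSubmodule F (Fintype.card F - 1) →ₗ[F] V :=
      -∑ x, ((evalOrth x).comp (Submodule.subtype _)).smulRight (f x)
    have hφ : ∀ s : simpleSubmodule F (Fintype.card F - 1),
        φ s = -∑ x, evalOrth x (s : MvPolynomial (Fin 2) F) • f x := fun s => by simp [φ]
    have hpoint : ∀ x, φ (pointVector x) = f x := fun x => by
      have h : ∀ y, evalOrth y (pointVector x : MvPolynomial (Fin 2) F)
          = if x = y then 0 else 1 := fun y => by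
        rw [pointVector, evalOrth_linearForm_pow, cross_rep_pow]
      simp only [hφ, h]
      rw [sum_ite_smul, hf0, zero_sub, neg_neg]
    refine ⟨φ.intertwiningMap_of_isIntertwiningMap _ _ fun g s => ?_, ?_⟩
    -- Writing `s` as a combination of point vectors reduces equivariance to these vectors.
    · rw [← neg_inj, ← map_neg, ← map_neg, ← map_neg, ← map_neg, ← sum_evalOrth_smul_pointVector]
      simp only [map_sum, map_smul, steinberg_pointVector, hpoint, hf g]
    · exact Subtype.ext (funext hpoint)

theorem finrank_intertwiningMap_steinberg
    (ρ : Representation F (SpecialLinearGroup (Fin 2) F) V) :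
    finrank F (Representation.IntertwiningMap (steinberg F) ρ)
      = finrank F (sumZeroMaps ρ (Points F F)) :=
  (LinearEquiv.ofBijective _ (restrictPoints_bijective ρ)).finrank_eq

end Steinberg

/-! ### Extension of scalars -/

section ExtendScalars

open scoped TensorProduct

variable {F G V : Type*} (κ : Type*) [Field F] [Field κ] [Algebra F κ] [Group G] [AddCommGroup V]
  [Module F V]

/-- The extension of scalars of a representation. -/
def extendScalars (ρ : Representation F G V) : Representation κ G (κ ⊗[F] V) where
  toFun g := (ρ g).baseChange κ
  map_one' := by rw [map_one]; exact LinearMap.baseChange_id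
  map_mul' g h := by rw [map_mul]; exact LinearMap.baseChange_comp _ _

theorem extendScalars_apply (ρ : Representation F G V) (g : G) :
    extendScalars κ ρ g = (ρ g).baseChange κ := rfl

theorem finrank_mul_finrank_submodule {M : Type*} [AddCommGroup M] [Module κ M] [Module F M]
    [IsScalarTower F κ M] (S : Submodule κ M) : finrank F κ * finrank κ S = finrank F S :=
  Module.finrank_mul_finrank F κ S

theorem exists_extendScalars_equiv [Module.Finite F κ] (ρ : Representation F G V) :
    ∃ e : κ ⊗[F] V ≃ₗ[F] (Fin (finrank F κ) → V),
      ∀ g w i, e (extendScalars κ ρ g w) i = ρ g (e w i) := by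
  let b := Module.finBasis F κ
  refine ⟨TensorProduct.equivFinsuppOfBasisLeft b ≪≫ₗ Finsupp.linearEquivFunOnFinite F V _,
    fun g w i => ?_⟩
  induction w with
  | zero => simp
  | add x y hx hy => simp only [map_add, Pi.add_apply, hx, hy]
  | tmul c v => simp [extendScalars_apply]

/-- Over `F`, the extended representation is a sum of `[κ : F]` copies of `ρ`, so the `F`-dimension
is multiplied by `[κ : F]`; dividing by this gives the `κ`-dimension. -/
theorem finrank_sumZeroMaps_extendScalars [Module.Finite F κ] [Module.Finite F V]
    (ρ : Representation F G V) (X : Type*) [MulAction G X] [Fintype X] :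
    finrank κ (sumZeroMaps (extendScalars κ ρ) X) = finrank F (sumZeroMaps ρ X) := by
  obtain ⟨e, he⟩ := exists_extendScalars_equiv κ ρ
  have he' : ∀ g (w : Fin (finrank F κ) → V),
      e.symm (fun i => ρ g (w i)) = extendScalars κ ρ g (e.symm w) := by
    intro g w
    rw [LinearEquiv.symm_apply_eq]
    funext i
    rw [he, LinearEquiv.apply_symm_apply]
  let E : sumZeroMaps (extendScalars κ ρ) X →ₗ[F] (Fin (finrank F κ) → sumZeroMaps ρ X) :=
    { toFun f i := ⟨fun x => e (f.1 x) i, by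
        obtain ⟨hf, hf0⟩ := mem_sumZeroMaps.1 f.2
        refine mem_sumZeroMaps.2 ⟨fun g x => by simp only [hf g x, he], ?_⟩
        rw [← Finset.sum_apply, ← map_sum, hf0, map_zero, Pi.zero_apply]⟩
      map_add' f f' := by
        funext i
        refine Subtype.ext (funext fun x => ?_)
        simp
      map_smul' c f := by
        funext i
        refine Subtype.ext (funext fun x => ?_)
        simp }
  have hE : Function.Bijective E := by
    constructor
    · intro f f' h
      refine Subtype.ext (funext fun x => e.injective (funext fun i => ?_))
      exact congrFun (congrArg Subtype.val (congrFun h i)) x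
    · intro f
      refine ⟨⟨fun x => e.symm fun i => (f i).1 x, mem_sumZeroMaps.2 ⟨fun g x => ?_, ?_⟩⟩, ?_⟩
      · simp only
        rw [← he']
        congr 1
        funext i
        exact (mem_sumZeroMaps.1 (f i).2).1 g x
      · rw [← map_sum, LinearEquiv.map_eq_zero_iff]
        funext i
        rw [Finset.sum_apply]
        exact (mem_sumZeroMaps.1 (f i).2).2
      · funext i
        refine Subtype.ext (funext fun x => ?_)
        simp [E]
  have h := (LinearEquiv.ofBijective E hE).finrank_eq
  rw [← finrank_mul_finrank_submodule κ (sumZeroMaps (extendScalars κ ρ) X), Module.finrank_pi_fintype, Finset.sum_const,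
    Finset.card_univ, Fintype.card_fin, smul_eq_mul] at h
  exact Nat.eq_of_mul_eq_mul_left Module.finrank_pos h

end ExtendScalars

/-! ### Averages of Brauer characters over cyclic groups -/

section Brauer

open Polynomial in
-- With a primitive `n`-th root of unity in `κ`, `X ^ n - 1` is a product of distinct linear
-- factors. The kernel of a product of coprime polynomials in `A` is the sum of the kernels, so
-- eigenvectors span.
theorem exists_basis_eigenvectors {κ W : Type*} [Field κ] [AddCommGroup W] [Module κ W]
    [Module.Finite κ W] {A : Module.End κ W} {n : ℕ} (hn : 0 < n) (hA : A ^ n = 1) {ζ : κ}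
    (hζ : IsPrimitiveRoot ζ n) :
    ∃ (m : ℕ) (b : Module.Basis (Fin m) κ W) (μ : Fin m → κ),
      ∀ i, μ i ^ n = 1 ∧ A (b i) = μ i • b i := by
  let S : Set W := {v | ∃ μ : κ, μ ^ n = 1 ∧ A v = μ • v}
  have hker : ∀ s : Finset κ, (∀ μ ∈ s, μ ^ n = 1) →
      LinearMap.ker (aeval A (∏ μ ∈ s, (X - C μ))) ≤ Submodule.span κ S := by
    classical
    intro s
    induction s using Finset.induction_on with
    | empty =>
      intro _
      rw [Finset.prod_empty, map_one, Module.End.one_eq_id, LinearMap.ker_id]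
      exact bot_le
    | insert a s has ih =>
      intro hs
      have hcop : IsCoprime (X - C a) (∏ μ ∈ s, (X - C μ)) :=
        IsCoprime.prod_right fun μ hμ => Polynomial.isCoprime_X_sub_C_of_isUnit_sub
          (IsUnit.mk0 _ (sub_ne_zero.2 fun h => has (h ▸ hμ)))
      rw [Finset.prod_insert has, ← Polynomial.sup_ker_aeval_eq_ker_aeval_mul_of_coprime _ hcop]
      refine sup_le (fun v hv => Submodule.subset_span ⟨a, hs a (Finset.mem_insert_self _ _), ?_⟩)
        (ih fun μ hμ => hs μ (Finset.mem_insert_of_mem hμ))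
      simpa [sub_eq_zero] using hv
  have htop : ⊤ ≤ Submodule.span κ S := by
    intro v _
    refine hker (nthRootsFinset n (1 : κ)) (fun μ hμ => (mem_nthRootsFinset hn 1).1 hμ) ?_
    rw [← X_pow_sub_one_eq_prod hn hζ]
    simp [hA]
  let b := Module.Basis.ofSpan htop
  have hb : ∀ i, b i ∈ S := fun i => Module.Basis.ofSpan_subset htop ⟨i, rfl⟩
  choose μ hμ hμA using hb
  have := FiniteDimensional.fintypeBasisIndex b
  let σ := Fintype.equivFin ↑((linearIndepOn_empty κ id).extend (Set.empty_subset S))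
  refine ⟨_, b.reindex σ, μ ∘ σ.symm, fun i => ⟨hμ _, ?_⟩⟩
  rw [Module.Basis.reindex_apply]
  exact hμA _

theorem charpoly_roots_of_eigenvectors {κ W ι : Type*} [Field κ] [AddCommGroup W] [Module κ W]
    [Module.Finite κ W] [Fintype ι] (b : Module.Basis ι κ W) {A : Module.End κ W} {μ : ι → κ}
    (h : ∀ i, A (b i) = μ i • b i) : A.charpoly.roots = Finset.univ.val.map μ := by
  classical
  have hdiag : LinearMap.toMatrix b b A = Matrix.diagonal μ := by
    ext i j
    rw [LinearMap.toMatrix_apply, h, map_smul, Module.Basis.repr_self, Finsupp.smul_single,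
      smul_eq_mul, mul_one, Matrix.diagonal_apply, Finsupp.single_apply]
    split_ifs with h1 h2 h2
    · rw [h1]
    · exact absurd h1.symm h2
    · exact absurd h2.symm h1
    · rfl
  rw [← LinearMap.charpoly_toMatrix A b, hdiag, Matrix.charpoly_diagonal]
  exact Polynomial.roots_multiset_prod_X_sub_C (Finset.univ.val.map μ) ▸ by
    rw [Multiset.map_map]; rfl

theorem finrank_ker_sub_one_of_eigenvectors {κ W ι : Type*} [Field κ] [AddCommGroup W] [Module κ W]
    [Fintype ι] (b : Module.Basis ι κ W) {A : Module.End κ W} {μ : ι → κ}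
    (h : ∀ i, A (b i) = μ i • b i) (S : Submodule κ W) (hS : ∀ w, w ∈ S ↔ A w = w)
    [DecidablePred fun i => μ i = 1] :
    finrank κ S = (Finset.univ.filter fun i => μ i = 1).card := by
  have hspan : S = Submodule.span κ (Set.range fun i : {i // μ i = 1} => b i) := by
    refine le_antisymm (fun w hw => ?_) (Submodule.span_le.2 ?_)
    · have hrepr : ∀ i, μ i * b.repr w i = b.repr w i := fun i => by
        have h1 : b.repr (A w) i = μ i * b.repr w i := by
          conv_lhs => rw [← b.sum_repr w]
          simp only [map_sum, map_smul, h, Finsupp.coe_finsetSum, Finset.sum_apply,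
            Module.Basis.repr_self, Finsupp.smul_apply, smul_eq_mul]
          rw [Finset.sum_eq_single i]
          · rw [Finsupp.single_eq_same]; ring
          · intro j _ hj
            rw [Finsupp.single_eq_of_ne' hj]; ring
          · simp
        rw [← h1, (hS w).1 hw]
      rw [← b.sum_repr w]
      refine Submodule.sum_mem _ fun i _ => ?_
      by_cases hi : μ i = 1
      · exact Submodule.smul_mem _ _ (Submodule.subset_span ⟨⟨i, hi⟩, rfl⟩)
      · have : b.repr w i = 0 := by
          have h2 : (μ i - 1) * b.repr w i = 0 := by rw [sub_mul, hrepr, one_mul, sub_self]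
          exact (mul_eq_zero.1 h2).resolve_left (sub_ne_zero.2 hi)
        rw [this, zero_smul]
        exact Submodule.zero_mem _
    · rintro _ ⟨i, rfl⟩
      exact (hS _).2 (by rw [h, i.2, one_smul])
  have hcard := finrank_span_eq_card (b.linearIndependent.comp (fun i : {i // μ i = 1} => i.1)
    Subtype.val_injective)
  rw [hspan, ← Fintype.card_subtype, ← hcard]
  rfl

/-- The lift is faithful on `κˣ` because the order of `ξ` is exactly `#κˣ`. -/
theorem rootLift_eq_one {κ : Type*} [Field κ] [Fintype κ] {α : κˣ}
    {hα : ∀ x : κˣ, x ∈ Subgroup.zpowers α} {ξ : ℂˣ} {hξ : IsPrimitiveRoot ξ (Nat.card κˣ)}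
    {x : κ} (hx : x ≠ 0) (h : rootLift α hα ξ hξ x = 1) : x = 1 := by
  classical
  obtain ⟨k, hk⟩ := mem_powers_iff_mem_zpowers.2 (hα (Units.mk0 x hx))
  have hx' : x = (α : κ) ^ k := by
    have := congrArg Units.val hk
    simpa using this.symm
  have hgen : rootLift α hα ξ hξ α = ξ := MulChar.ofRootOfUnity_spec _ _
  rw [hx', map_pow, hgen] at h
  have hdvd : Nat.card κˣ ∣ k := hξ.dvd_of_pow_eq_one k (Units.ext (by simpa using h))
  obtain ⟨m, rfl⟩ := hdvd
  rw [hx', pow_mul, ← Units.val_pow_eq_pow_val, pow_card_eq_one', Units.val_one, one_pow]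

theorem sum_rootLift_pow {κ : Type*} [Field κ] [Fintype κ] {α : κˣ}
    {hα : ∀ x : κˣ, x ∈ Subgroup.zpowers α} {ξ : ℂˣ} {hξ : IsPrimitiveRoot ξ (Nat.card κˣ)}
    {x : κ} {n : ℕ} (hn : 0 < n) (hx : x ^ n = 1) [Decidable (x = 1)] :
    ∑ j ∈ Finset.range n, rootLift α hα ξ hξ (x ^ j) = if x = 1 then (n : ℂ) else 0 := by
  split_ifs with h1
  · simp [h1]
  · have hx0 : x ≠ 0 := by
      rintro rfl
      rw [zero_pow hn.ne'] at hx
      exact zero_ne_one hx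
    have hne : rootLift α hα ξ hξ x - 1 ≠ 0 := sub_ne_zero.2 fun h => h1 (rootLift_eq_one hx0 h)
    refine (mul_eq_zero.1 ?_).resolve_right hne
    simp only [map_pow]
    rw [geom_sum_mul, ← map_pow, hx, map_one, sub_self]

variable {F κ G V : Type*} [Field F] [Field κ] [Algebra F κ] [Group G]
    [AddCommGroup V] [Module F V] [Module.Finite F V]

theorem brauerCharacter_eq_of_isConj (χ : MulChar κ ℂ) (ρ : Representation F G V) {g h : G}
    (hgh : IsConj g h) : brauerCharacter χ ρ g = brauerCharacter χ ρ h := by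
  obtain ⟨c, hc⟩ := isConj_iff.1 hgh
  let e : V ≃ₗ[F] V := LinearEquiv.ofLinearMap (ρ c) (ρ c⁻¹)
    (by rw [← Module.End.mul_eq_comp, ← map_mul, mul_inv_cancel, map_one]; rfl)
    (by rw [← Module.End.mul_eq_comp, ← map_mul, inv_mul_cancel, map_one]; rfl)
  have h : ρ h = e.conj (ρ g) := by
    rw [← hc, map_mul, map_mul]
    rfl
  rw [brauerCharacter, brauerCharacter, h, LinearEquiv.charpoly_conj]

open Polynomial in
/-- The average of the Brauer character over a cyclic group of order `n` such that `κ` contains a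
primitive `n`-th root of unity is the dimension of the space of fixed vectors. -/
theorem sum_brauerCharacter_eq [Fintype κ] {α : κˣ}
    {hα : ∀ x : κˣ, x ∈ Subgroup.zpowers α} {ξ : ℂˣ} {hξ : IsPrimitiveRoot ξ (Nat.card κˣ)}
    (ρ : Representation F G V) {n : ℕ} (hn : 0 < n) {ζ : κ} (hζ : IsPrimitiveRoot ζ n)
    {h₀ : G} (hpow : h₀ ^ n = 1) {H : Subgroup G} (hmem : h₀ ∈ H) (hH : ∀ h ∈ H, ∃ j : ℕ, h = h₀ ^ j)
    {f : κ → G} (hf : ∀ j, IsConj (f (ζ ^ j)) (h₀ ^ j)) :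
    ∑ z ∈ nthRootsFinset n (1 : κ), brauerCharacter (rootLift α hα ξ hξ) ρ (f z)
      = n * finrank κ (fixedVectors (extendScalars κ ρ) H) := by
  classical
  have : NeZero n := ⟨hn.ne'⟩
  -- `f` need not be a homomorphism: conjugacy of `f (ζ ^ j)` to `h₀ ^ j` suffices, as the Brauer
  -- character is a class function.
  have hsum : ∑ z ∈ nthRootsFinset n (1 : κ), brauerCharacter (rootLift α hα ξ hξ) ρ (f z)
      = ∑ j ∈ Finset.range n, brauerCharacter (rootLift α hα ξ hξ) ρ (h₀ ^ j) := by
    symm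
    refine Finset.sum_bij (fun j _ => ζ ^ j) ?_ ?_ ?_ ?_
    · intro j _
      rw [mem_nthRootsFinset hn, ← pow_mul, mul_comm, pow_mul, hζ.pow_eq_one, one_pow]
    · intro i hi j hj h
      exact hζ.pow_inj (Finset.mem_range.1 hi) (Finset.mem_range.1 hj) h
    · intro z hz
      obtain ⟨i, hi, h⟩ := hζ.eq_pow_of_pow_eq_one ((mem_nthRootsFinset hn 1).1 hz)
      exact ⟨i, Finset.mem_range.2 hi, h⟩
    · intro j _
      exact (brauerCharacter_eq_of_isConj _ ρ (hf j)).symm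
  obtain ⟨m, b, μ, hb⟩ := exists_basis_eigenvectors (A := extendScalars κ ρ h₀) hn
    (by rw [← map_pow, hpow, map_one]) hζ
  have hbpow : ∀ j i, (extendScalars κ ρ (h₀ ^ j)) (b i) = (μ i ^ j) • b i := by
    intro j i
    induction j with
    | zero => simp
    | succ j ih => rw [pow_succ, map_mul, Module.End.mul_apply, (hb i).2, map_smul, ih, smul_smul,
        pow_succ, mul_comm]
  have hchar : ∀ j, brauerCharacter (rootLift α hα ξ hξ) ρ (h₀ ^ j)
      = ∑ i, rootLift α hα ξ hξ (μ i ^ j) := by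
    intro j
    rw [brauerCharacter, ← LinearMap.charpoly_baseChange, ← extendScalars_apply,
      charpoly_roots_of_eigenvectors b (hbpow j), Multiset.map_map]
    rfl
  have hfix : ∀ w, w ∈ fixedVectors (extendScalars κ ρ) H ↔ extendScalars κ ρ h₀ w = w := by
    refine fun w => ⟨fun hw => hw h₀ hmem, fun hw h hh => ?_⟩
    obtain ⟨j, rfl⟩ := hH h hh
    induction j with
    | zero => simp
    | succ j ih => rw [pow_succ, map_mul, Module.End.mul_apply, hw,
        ih (H.pow_mem hmem j)]
  -- After exchanging the sums, each eigenvalue of `h₀` contributes `n` if it is `1` and `0`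
  -- otherwise.
  rw [hsum, Finset.sum_congr rfl fun j _ => hchar j, Finset.sum_comm,
    finrank_ker_sub_one_of_eigenvectors b (fun i => (hb i).2) _ hfix,
    Finset.sum_congr rfl fun i _ => sum_rootLift_pow hn (hb i).1, Finset.sum_ite,
    Finset.sum_const_zero, add_zero, Finset.sum_const, nsmul_eq_mul, mul_comm]

end Brauer

/-! ### The two kinds of tori -/

section TorusMatrix

variable {F K : Type*} [Field F] [Field K] [Algebra F K]

theorem torusMatrix_one : torusMatrix F (1 : K) = 1 := if_pos rfl

theorem torusMatrix_neg_one : torusMatrix F (-1 : K) = -1 := by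
  by_cases h : (-1 : K) = 1
  · have hF : (-1 : F) = 1 := (algebraMap F K).injective (by simpa using h)
    rw [h, torusMatrix_one]
    refine Subtype.ext ?_
    ext i j
    fin_cases i <;> fin_cases j <;> simp [hF]
  · exact (if_neg h).trans (if_pos rfl)

theorem torusMatrix_val {ζ : K} (h1 : ζ ≠ 1) (h2 : ζ ≠ -1) :
    (torusMatrix F ζ).1 = !![0, -1; 1, torusTrace F ζ] :=
  congrArg Subtype.val ((if_neg h1).trans (if_neg h2))

variable [Fintype F] [Fintype K]

/-- Lets the tori be studied over `F` or `K`, where the relevant roots of unity already live,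
instead of over `κ`. -/
theorem torusMatrix_algebraMap {κ : Type*} [Field κ] [Fintype κ] [Algebra F κ] [Algebra K κ]
    [IsScalarTower F K κ] {ζ : K}
    (hζ : ζ ^ (Fintype.card F - 1) = 1 ∨ ζ ^ (Fintype.card F + 1) = 1) :
    torusMatrix F (algebraMap K κ ζ) = torusMatrix F ζ := by
  have hinj := (algebraMap K κ).injective
  by_cases h1 : ζ = 1
  · rw [h1, map_one, torusMatrix_one, torusMatrix_one]
  by_cases h2 : ζ = -1
  · rw [h2, map_neg, map_one, torusMatrix_neg_one, torusMatrix_neg_one]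
  have h1' : algebraMap K κ ζ ≠ 1 := fun h => h1 (hinj (by rw [h, map_one]))
  have h2' : algebraMap K κ ζ ≠ -1 := fun h => h2 (hinj (by rw [h, map_neg, map_one]))
  have hζ' : algebraMap K κ ζ ^ (Fintype.card F - 1) = 1
      ∨ algebraMap K κ ζ ^ (Fintype.card F + 1) = 1 := by
    rw [← map_pow, ← map_pow]
    exact hζ.imp (fun h => by rw [h, map_one]) (fun h => by rw [h, map_one])
  have htrace : torusTrace F (algebraMap K κ ζ) = torusTrace F ζ := by
    refine (algebraMap F κ).injective ?_
    rw [algebraMap_torusTrace _ hζ', IsScalarTower.algebraMap_apply F K κ,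
      algebraMap_torusTrace _ hζ, map_add, map_inv₀]
  refine Subtype.ext ?_
  rw [torusMatrix_val h1' h2', torusMatrix_val h1 h2, htrace]

theorem act_torusMatrix {ζ : K}
    (hζ : ζ ^ (Fintype.card F - 1) = 1 ∨ ζ ^ (Fintype.card F + 1) = 1) (h1 : ζ ≠ 1) (h2 : ζ ≠ -1) :
    act (torusMatrix F ζ) ![1, -ζ] = ζ • ![1, -ζ] := by
  have h0 : ζ ≠ 0 := by
    rintro rfl
    have hF : 1 < Fintype.card F := Fintype.one_lt_card
    rcases hζ with h | h <;> rw [zero_pow (by omega)] at h <;> exact zero_ne_one h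
  funext i
  rw [act_apply, torusMatrix_val h1 h2]
  fin_cases i
  · simp
  · simp [algebraMap_torusTrace ζ hζ]
    field_simp
    ring

theorem exists_isPrimitiveRoot (L : Type*) [Field L] [Fintype L] {n : ℕ}
    (hn : n ∣ Fintype.card L - 1) : ∃ ζ : L, IsPrimitiveRoot ζ n := by
  classical
  obtain ⟨u, hu⟩ := IsCyclic.exists_generator (α := Lˣ)
  have h := IsPrimitiveRoot.orderOf u
  rw [orderOf_eq_card_of_forall_mem_zpowers hu, Nat.card_eq_fintype_card,
    Fintype.card_units] at h
  obtain ⟨m, hm⟩ := hn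
  have hL : 1 < Fintype.card L := Fintype.one_lt_card
  exact ⟨((u ^ m : Lˣ) : L), (h.pow (by omega) (by rw [hm, mul_comm])).map_of_injective
    (f := Units.coeHom L) Units.val_injective⟩

end TorusMatrix

/-! ### The split torus as the stabilizer of a pair of rational points -/

section Split

variable {F : Type*} [Field F]

/-- The diagonal matrix with entries `a` and `a⁻¹`. -/
def splitTorus : Fˣ →* SpecialLinearGroup (Fin 2) F where
  toFun a := ⟨!![(a : F), 0; 0, (a : F)⁻¹], by simp [Matrix.det_fin_two]⟩
  map_one' := by
    refine Subtype.ext ?_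
    ext i j
    fin_cases i <;> fin_cases j <;> simp
  map_mul' a b := by
    refine Subtype.ext ?_
    ext i j
    change _ = (!![(a : F), 0; 0, (a : F)⁻¹] * !![(b : F), 0; 0, (b : F)⁻¹]) i j
    fin_cases i <;> fin_cases j <;> simp [mul_comm]

theorem splitTorus_val (a : Fˣ) : (splitTorus a).1 = !![(a : F), 0; 0, (a : F)⁻¹] := rfl

theorem isConj_splitTorus [Fintype F] (a : Fˣ) :
    IsConj (torusMatrix F (a : F)) (splitTorus a) := by
  by_cases h1 : (a : F) = 1
  · rw [h1, torusMatrix_one, show a = 1 from Units.ext h1, map_one]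
  by_cases h2 : (a : F) = -1
  · have : splitTorus a = -1 := by
      refine Subtype.ext ?_
      rw [splitTorus_val, h2]
      ext i j
      fin_cases i <;> fin_cases j <;> simp
    rw [h2, torusMatrix_neg_one, this]
  have hpow : (a : F) ^ (Fintype.card F - 1) = 1 :=
    FiniteField.pow_card_sub_one_eq_one _ a.ne_zero
  have htrace : torusTrace F (a : F) = a + (a : F)⁻¹ := algebraMap_torusTrace (a : F) (Or.inl hpow)
  have ha := a.ne_zero
  have hne : 1 - (a : F) ^ 2 ≠ 0 := by
    have : 1 - (a : F) ^ 2 = (1 - a) * (1 + a) := by ring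
    rw [this]
    exact mul_ne_zero (sub_ne_zero.2 (Ne.symm h1))
      (fun h => h2 (eq_neg_of_add_eq_zero_right h))
  -- The rows of `P` are left eigenvectors of the companion matrix for `a` and `a⁻¹`; the factor `c`
  -- makes the determinant `c * (a⁻¹ - a)` equal to `1`.
  let c : F := a / (1 - (a : F) ^ 2)
  let P : SpecialLinearGroup (Fin 2) F := ⟨!![1, (a : F); c, c * (a : F)⁻¹], by
    rw [Matrix.det_fin_two_of]
    simp only [c]
    field_simp⟩
  rw [isConj_iff]
  refine ⟨P, ?_⟩
  rw [mul_inv_eq_iff_eq_mul]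
  refine Subtype.ext ?_
  change P.1 * (torusMatrix F (a : F)).1 = (splitTorus a).1 * P.1
  rw [torusMatrix_val h1 h2, htrace, splitTorus_val]
  ext i j
  fin_cases i <;> fin_cases j <;> simp [P, Matrix.mul_apply, Fin.sum_univ_two] <;> field_simp <;> ring

/-- The pair of coordinate points of the projective line. -/
def coordinatePoints (F : Type*) [Field F] : Points F F × Points F F :=
  (Points.mk F ![1, 0] (by simp), Points.mk F ![0, 1] (by simp))

theorem coordinatePoints_ne : (coordinatePoints F).1 ≠ (coordinatePoints F).2 := by
  rw [coordinatePoints, Ne, Points.mk_eq_mk_iff_cross]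
  simp [cross]

theorem mem_orbit_coordinatePoints {p : Points F F × Points F F} (hp : p.1 ≠ p.2) :
    p ∈ MulAction.orbit (SpecialLinearGroup (Fin 2) F) (coordinatePoints F) := by
  have hd : cross p.1.rep p.2.rep ≠ 0 := fun h => hp (Points.eq_iff_cross.2 h)
  -- The columns represent the two points; rescaling the second makes the determinant `1`.
  let g : SpecialLinearGroup (Fin 2) F :=
    ⟨!![p.1.rep 0, (cross p.1.rep p.2.rep)⁻¹ * p.2.rep 0;
      p.1.rep 1, (cross p.1.rep p.2.rep)⁻¹ * p.2.rep 1], by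
        rw [Matrix.det_fin_two_of]
        field_simp
        rw [cross]
        ring⟩
  refine ⟨g, Prod.ext ?_ ?_⟩
  · change g • Points.mk F _ _ = p.1
    rw [smul_mk, ← p.1.mk_rep]
    refine Points.mk_eq_mk_iff.2 ⟨1, funext fun i => ?_⟩
    rw [act_apply]
    fin_cases i <;> simp [g]
  · change g • Points.mk F _ _ = p.2
    rw [smul_mk, ← p.2.mk_rep]
    refine Points.mk_eq_mk_iff.2 ⟨(cross p.1.rep p.2.rep)⁻¹, funext fun i => ?_⟩
    rw [act_apply]
    fin_cases i <;> simp [g]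

theorem splitTorus_mem_stabilizer (a : Fˣ) :
    splitTorus a ∈ MulAction.stabilizer (SpecialLinearGroup (Fin 2) F) (coordinatePoints F) := by
  rw [MulAction.mem_stabilizer_iff]
  refine Prod.ext ?_ ?_
  · change splitTorus a • Points.mk F _ _ = Points.mk F _ _
    rw [smul_mk, Points.mk_eq_mk_iff_cross, cross]
    simp [act_apply, splitTorus_val]
  · change splitTorus a • Points.mk F _ _ = Points.mk F _ _
    rw [smul_mk, Points.mk_eq_mk_iff_cross, cross]
    simp [act_apply, splitTorus_val]

theorem exists_eq_splitTorus {h : SpecialLinearGroup (Fin 2) F}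
    (hh : h ∈ MulAction.stabilizer (SpecialLinearGroup (Fin 2) F) (coordinatePoints F)) :
    ∃ a : Fˣ, h = splitTorus a := by
  have h1 : h • Points.mk F ![(1 : F), 0] _ = Points.mk F ![1, 0] _ := congrArg Prod.fst hh
  have h2 : h • Points.mk F ![(0 : F), 1] _ = Points.mk F ![0, 1] _ := congrArg Prod.snd hh
  rw [smul_mk, Points.mk_eq_mk_iff_cross, cross] at h1 h2
  simp [act_apply] at h1 h2
  have hdet := h.2
  rw [Matrix.det_fin_two, h1, mul_zero, sub_zero] at hdet
  refine ⟨Units.mkOfMulEqOne _ _ hdet, Subtype.ext ?_⟩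
  rw [splitTorus_val]
  ext i j
  fin_cases i <;> fin_cases j <;> simp [h1, h2]
  exact eq_inv_of_mul_eq_one_right hdet

end Split

/-! ### The nonsplit torus as the stabilizer of a nonrational point over the quadratic extension -/

section Nonsplit

variable {F K : Type*} [Field F] [Field K] [Algebra F K]

/-- The point `(1 : -ζ)` of the projective line. -/
def eigenPoint (F : Type*) {K : Type*} [Field K] (ζ : K) : Points F K :=
  Points.mk F ![1, -ζ] (by simp)

theorem eigenPoint_mem_range_iff {ζ : K} :
    eigenPoint F ζ ∈ Set.range (ofRational (F := F) K) ↔ ζ ∈ Set.range (algebraMap F K) := by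
  constructor
  · rintro ⟨x, hx⟩
    have h := Points.mk_eq_mk_iff_cross.1 hx
    simp only [cross, Matrix.cons_val_zero, Matrix.cons_val_one] at h
    have h0 : x.rep 0 ≠ 0 := by
      intro h0
      have h1 : x.rep 1 = 0 := by simpa [h0] using h
      exact x.rep_ne_zero (by funext i; fin_cases i <;> simp [h0, h1])
    refine ⟨-x.rep 1 / x.rep 0, ?_⟩
    have h0' : algebraMap F K (x.rep 0) ≠ 0 := (map_ne_zero _).2 h0
    rw [map_div₀, map_neg, div_eq_iff h0']
    linear_combination h
  · rintro ⟨a, rfl⟩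
    refine ⟨Points.mk F ![1, -a] (by simp), ?_⟩
    rw [ofRational_mk]
    refine Points.mk_eq_mk_iff.2 ⟨1, funext fun i => ?_⟩
    fin_cases i <;> simp

theorem add_mul_injective {ζ : K} (hζ : ζ ∉ Set.range (algebraMap F K)) {r s r' s' : F}
    (h : algebraMap F K r + algebraMap F K s * ζ = algebraMap F K r' + algebraMap F K s' * ζ) :
    r = r' ∧ s = s' := by
  have hs : s = s' := by
    by_contra hne
    refine hζ ⟨(r' - r) / (s - s'), ?_⟩
    have h0 : algebraMap F K (s - s') ≠ 0 := (map_ne_zero _).2 (sub_ne_zero.2 hne)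
    rw [map_div₀, div_eq_iff h0, map_sub, map_sub]
    linear_combination -h
  subst hs
  exact ⟨(algebraMap F K).injective (by linear_combination h), rfl⟩

/-- The matrix entries are coordinates with respect to the independent elements `1`, `ζ`. Identities
in `SL₂(F)` can therefore be tested on the single vector `(1, -ζ)`. -/
theorem eq_of_act_eq {ζ : K} (hζ : ζ ∉ Set.range (algebraMap F K))
    {g h : SpecialLinearGroup (Fin 2) F}
    (hgh : act g ![1, -ζ] = act h ![1, -ζ]) : g = h := by
  have h1 : ∀ i, g.1 i 0 = h.1 i 0 ∧ -g.1 i 1 = -h.1 i 1 := fun i => by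
    have h2 := congrFun hgh i
    simp only [act_apply, Matrix.cons_val_zero, Matrix.cons_val_one] at h2
    refine add_mul_injective hζ ?_
    rw [map_neg, map_neg]
    linear_combination h2
  refine Subtype.ext ?_
  ext i j
  fin_cases j
  · exact (h1 i).1
  · exact neg_inj.1 (h1 i).2

theorem smul_eigenPoint_of_act_eq {ζ c : K} {g : SpecialLinearGroup (Fin 2) F}
    (h : act g ![1, -ζ] = c • ![1, -ζ]) : g • eigenPoint F ζ = eigenPoint F ζ := by
  rw [eigenPoint, smul_mk, Points.mk_eq_mk_iff]
  exact ⟨c, h.symm⟩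

variable [Fintype F]

theorem eq_one_or_eq_neg_one {ζ : K} (hζ : ζ ^ (Fintype.card F + 1) = 1)
    (h : ζ ∈ Set.range (algebraMap F K)) : ζ = 1 ∨ ζ = -1 := by
  obtain ⟨a, rfl⟩ := h
  rw [pow_succ, ← map_pow, FiniteField.pow_card] at hζ
  exact mul_self_eq_one_iff.1 hζ

/-- Frobenius produces a second eigenvector with eigenvalue `c ^ q`, independent of the first since
`ζ ^ q ≠ ζ`. The determinant of `h` is then `c * c ^ q = 1`. -/
theorem eigenvalue_pow_card_add_one {ζ c : K} (hζ : ζ ∉ Set.range (algebraMap F K))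
    (hpow : ζ ^ (Fintype.card F + 1) = 1) {h : SpecialLinearGroup (Fin 2) F}
    (hh : act h ![1, -ζ] = c • ![1, -ζ]) : c ^ (Fintype.card F + 1) = 1 := by
  have hconj : act h ![1, -ζ ^ Fintype.card F] = c ^ Fintype.card F • ![1, -ζ ^ Fintype.card F] := by
    have hφ : ∀ a : F, FiniteField.frobeniusAlgHom F K (algebraMap F K a) = algebraMap F K a :=
      fun a => AlgHom.commutes _ a
    funext i
    have h1 := congrArg (FiniteField.frobeniusAlgHom F K) (congrFun hh i)
    simp only [act_apply, map_add, map_mul, hφ, Pi.smul_apply, smul_eq_mul] at h1 ⊢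
    simp only [FiniteField.coe_frobeniusAlgHom] at h1
    have hneg : (-ζ) ^ Fintype.card F = -ζ ^ Fintype.card F :=
      map_neg (FiniteField.frobeniusAlgHom F K) ζ
    fin_cases i <;> simpa [hneg] using h1
  have hcross := cross_act h ![1, -ζ] ![1, -ζ ^ Fintype.card F]
  rw [hh, hconj, cross_smul_left, cross_smul_right] at hcross
  have hne : cross ![1, -ζ] ![1, -ζ ^ Fintype.card F] ≠ 0 := by
    intro h0
    have h1 : ζ ^ Fintype.card F = ζ := by
      simp only [cross, Matrix.cons_val_zero, Matrix.cons_val_one] at h0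
      linear_combination -h0
    rw [pow_succ, h1] at hpow
    rcases mul_self_eq_one_iff.1 hpow with rfl | rfl
    · exact hζ ⟨1, map_one _⟩
    · exact hζ ⟨-1, by simp⟩
  refine mul_right_cancel₀ hne ?_
  linear_combination hcross

variable [Fintype K]

theorem exists_add_mul (hK : Fintype.card K = Fintype.card F ^ 2) {ζ : K}
    (hζ : ζ ∉ Set.range (algebraMap F K)) (w : K) :
    ∃ r s : F, w = algebraMap F K r + algebraMap F K s * ζ := by
  have hbij : Function.Bijective
      (fun p : F × F => algebraMap F K p.1 + algebraMap F K p.2 * ζ) := by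
    rw [Fintype.bijective_iff_injective_and_card]
    refine ⟨fun p p' h => ?_, by rw [Fintype.card_prod, hK, sq]⟩
    exact Prod.ext (add_mul_injective hζ h).1 (add_mul_injective hζ h).2
  obtain ⟨p, hp⟩ := hbij.2 w
  exact ⟨p.1, p.2, hp.symm⟩

theorem exists_norm_eq (hK : Fintype.card K = Fintype.card F ^ 2) (k : F) :
    ∃ c : K, c ^ (Fintype.card F + 1) = algebraMap F K k := by
  obtain ⟨c, hc⟩ := FiniteField.norm_surjective F K k
  refine ⟨c, ?_⟩
  have hF : 1 < Fintype.card F := Fintype.one_lt_card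
  rw [← hc, FiniteField.algebraMap_norm_eq_pow, Nat.card_eq_fintype_card, Nat.card_eq_fintype_card,
    hK]
  congr 1
  rw [show Fintype.card F ^ 2 - 1 = (Fintype.card F + 1) * (Fintype.card F - 1) by
    rw [← Nat.sq_sub_sq, one_pow], Nat.mul_div_cancel _ (by omega)]

/-- Write the point as `(1 : -(a + s ζ))`. The `F`-matrix carrying `(1, -ζ)` to this vector has
determinant `s`. Rescaling the vector by `c` of norm `s⁻¹`, which exists since the norm is
surjective, brings the determinant to `1`. -/
theorem mem_orbit_eigenPoint (hK : Fintype.card K = Fintype.card F ^ 2) {ζ : K}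
    (hζ : ζ ∉ Set.range (algebraMap F K)) (hpow : ζ ^ (Fintype.card F + 1) = 1) {p : Points F K}
    (hp : p ∉ Set.range (ofRational (F := F) K)) :
    p ∈ MulAction.orbit (SpecialLinearGroup (Fin 2) F) (eigenPoint F ζ) := by
  have h0 : p.rep 0 ≠ 0 := by
    intro h0
    refine hp ⟨Points.mk F ![0, 1] (by simp), ?_⟩
    rw [ofRational_mk, ← p.mk_rep, Points.mk_eq_mk_iff_cross, cross]
    simp [h0]
  have hpe : p = eigenPoint F (-(p.rep 1 / p.rep 0)) := by
    conv_lhs => rw [← p.mk_rep]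
    rw [eigenPoint, Points.mk_eq_mk_iff]
    refine ⟨p.rep 0, funext fun i => ?_⟩
    fin_cases i
    · simp
    · simp; field_simp
  generalize -(p.rep 1 / p.rep 0) = w at hpe
  subst hpe
  rw [eigenPoint_mem_range_iff] at hp
  obtain ⟨a, s, rfl⟩ := exists_add_mul hK hζ w
  have hs : s ≠ 0 := by
    rintro rfl
    exact hp ⟨a, by simp⟩
  obtain ⟨c, hc⟩ := exists_norm_eq hK s⁻¹
  obtain ⟨r, u, rfl⟩ := exists_add_mul hK hζ c
  have hτ := algebraMap_torusTrace (F := F) ζ (Or.inr hpow)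
  have hζ0 : ζ ≠ 0 := by
    rintro rfl
    exact hζ ⟨0, map_zero _⟩
  have hinv : ζ ^ Fintype.card F = ζ⁻¹ := by
    rw [pow_succ] at hpow
    exact eq_inv_of_mul_eq_one_left hpow
  generalize torusTrace F ζ = τ at hτ
  -- The second factor is the norm of `r + u ζ`, since `ζ ^ q = ζ⁻¹` and `ζ + ζ⁻¹ = τ`.
  have hdet : s * (r ^ 2 + r * u * τ + u ^ 2) = 1 := by
    refine (algebraMap F K).injective ?_
    have hfrob : (algebraMap F K r + algebraMap F K u * ζ) ^ Fintype.card F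
        = algebraMap F K r + algebraMap F K u * ζ⁻¹ := by
      rw [← hinv]
      have h := map_add (FiniteField.frobeniusAlgHom F K) (algebraMap F K r) (algebraMap F K u * ζ)
      rw [map_mul, AlgHom.commutes, AlgHom.commutes] at h
      exact h
    rw [pow_succ, hfrob, map_inv₀] at hc
    have hs' : algebraMap F K s ≠ 0 := (map_ne_zero _).2 hs
    have hc' := congrArg (fun x => x * algebraMap F K s) hc
    simp only [inv_mul_cancel₀ hs'] at hc'
    rw [map_one, ← hc']
    simp only [map_mul, map_add, map_pow, hτ]
    field_simp
    ring
  -- The rows are read off from the coordinates of `c` and `-c * (a + s ζ)` in `1`, `ζ`, using `ζ ^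
  -- 2 = τ ζ - 1`.
  let g : SpecialLinearGroup (Fin 2) F :=
    ⟨!![r, -u; -(a * r) + s * u, a * u + s * (r + u * τ)], by
      rw [Matrix.det_fin_two_of]
      linear_combination hdet⟩
  refine ⟨g, ?_⟩
  change g • Points.mk F _ _ = Points.mk F _ _
  rw [smul_mk, Points.mk_eq_mk_iff]
  refine ⟨algebraMap F K r + algebraMap F K u * ζ, funext fun i => ?_⟩
  rw [act_apply]
  fin_cases i
  · simp [g]
  · simp [g, hτ]
    field_simp
    ring

theorem act_torusMatrix_pow {ζ : K} (hζ : ζ ∉ Set.range (algebraMap F K))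
    (hpow : ζ ^ (Fintype.card F + 1) = 1) (j : ℕ) :
    act (torusMatrix F ζ ^ j) ![1, -ζ] = ζ ^ j • ![1, -ζ] := by
  have h1 : ζ ≠ 1 := fun h => hζ ⟨1, by rw [h, map_one]⟩
  have h2 : ζ ≠ -1 := fun h => hζ ⟨-1, by rw [h, map_neg, map_one]⟩
  induction j with
  | zero => rw [pow_zero, act_one, pow_zero, one_smul]
  | succ j ih =>
    rw [pow_succ, act_mul, act_torusMatrix (Or.inr hpow) h1 h2, act_smul, ih, smul_smul, pow_succ,
      mul_comm]

/-- An element of the stabilizer is determined by its eigenvalue, which is a `(q + 1)`-th root of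
unity and hence a power of `ζ`. -/
theorem exists_eq_torusMatrix_pow {ζ : K} (hζ : ζ ∉ Set.range (algebraMap F K))
    (hprim : IsPrimitiveRoot ζ (Fintype.card F + 1)) {h : SpecialLinearGroup (Fin 2) F}
    (hh : h ∈ MulAction.stabilizer (SpecialLinearGroup (Fin 2) F) (eigenPoint F ζ)) :
    ∃ j : ℕ, h = torusMatrix F ζ ^ j := by
  rw [MulAction.mem_stabilizer_iff, eigenPoint, smul_mk, Points.mk_eq_mk_iff] at hh
  obtain ⟨c, hc⟩ := hh
  obtain ⟨j, -, rfl⟩ := hprim.eq_pow_of_pow_eq_one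
    (eigenvalue_pow_card_add_one hζ hprim.pow_eq_one hc.symm)
  exact ⟨j, eq_of_act_eq hζ (by rw [act_torusMatrix_pow hζ hprim.pow_eq_one, hc])⟩

/-- Unless `ζ ^ j = ± 1`, some `g` moves the eigenpoint of `ζ` to that of `ζ ^ j`. After conjugation
both matrices have eigenvalue `ζ ^ j` on `(1, -ζ)`, hence agree. -/
theorem isConj_torusMatrix_pow (hK : Fintype.card K = Fintype.card F ^ 2) {ζ : K}
    (hζ : ζ ∉ Set.range (algebraMap F K)) (hpow : ζ ^ (Fintype.card F + 1) = 1) (j : ℕ) :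
    IsConj (torusMatrix F (ζ ^ j)) (torusMatrix F ζ ^ j) := by
  by_cases h1 : ζ ^ j = 1
  · have h : torusMatrix F ζ ^ j = 1 := eq_of_act_eq hζ (by
      rw [act_torusMatrix_pow hζ hpow, h1, one_smul, act_one])
    rw [h1, h, torusMatrix_one]
  by_cases h2 : ζ ^ j = -1
  · have h : torusMatrix F ζ ^ j = -1 := eq_of_act_eq hζ (by
      rw [act_torusMatrix_pow hζ hpow, h2]
      funext i
      rw [act_apply]
      fin_cases i <;> simp)
    rw [h2, h, torusMatrix_neg_one]
  have hpow' : (ζ ^ j) ^ (Fintype.card F + 1) = 1 := by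
    rw [← pow_mul, mul_comm, pow_mul, hpow, one_pow]
  have hnot : eigenPoint F (ζ ^ j) ∉ Set.range (ofRational (F := F) K) := fun h => by
    rcases eq_one_or_eq_neg_one hpow' (eigenPoint_mem_range_iff.1 h) with h | h
    · exact h1 h
    · exact h2 h
  obtain ⟨g, hg⟩ := mem_orbit_eigenPoint hK hζ hpow hnot
  change g • Points.mk F _ _ = Points.mk F _ _ at hg
  rw [smul_mk, Points.mk_eq_mk_iff] at hg
  obtain ⟨a, ha⟩ := hg
  refine isConj_iff.2 ⟨g⁻¹, eq_of_act_eq hζ ?_⟩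
  rw [inv_inv, act_mul, act_mul, ← ha, act_smul, act_torusMatrix (Or.inr hpow') h1 h2, smul_comm,
    ha, act_smul, act_inv_act, act_torusMatrix_pow hζ hpow]

end Nonsplit

/-! ### Averages over the tori -/

section TorusAverages

variable {F κ V : Type*} [Field F] [Fintype F] [Field κ] [Fintype κ] [Algebra F κ]
  [AddCommGroup V] [Module F V] [Module.Finite F V] {α : κˣ}
  {hα : ∀ x : κˣ, x ∈ Subgroup.zpowers α} {ξ : ℂˣ} {hξ : IsPrimitiveRoot ξ (Nat.card κˣ)}

theorem sum_brauerCharacter_split (ρ : Representation F (SpecialLinearGroup (Fin 2) F) V) :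
    ∑ ζ ∈ Polynomial.nthRootsFinset (Fintype.card F - 1) (1 : κ),
        brauerCharacter (rootLift α hα ξ hξ) ρ (torusMatrix F ζ)
      = (Fintype.card F - 1 : ℕ) * finrank κ (fixedVectors (extendScalars κ ρ)
          (MulAction.stabilizer _ (coordinatePoints F))) := by
  have hF : 1 < Fintype.card F := Fintype.one_lt_card
  have hn : 0 < Fintype.card F - 1 := by omega
  have : NeZero (Fintype.card F - 1) := ⟨hn.ne'⟩
  obtain ⟨ζ, hζ⟩ := exists_isPrimitiveRoot F (dvd_refl (Fintype.card F - 1))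
  let u : Fˣ := Units.mk0 ζ (hζ.ne_zero hn.ne')
  have hpow : ∀ a : Fˣ, (a : F) ^ (Fintype.card F - 1) = 1 :=
    fun a => FiniteField.pow_card_sub_one_eq_one _ a.ne_zero
  refine sum_brauerCharacter_eq (h₀ := splitTorus u) ρ hn
    (hζ.map_of_injective (algebraMap F κ).injective) ?_ (splitTorus_mem_stabilizer u) ?_ ?_
  · rw [← map_pow, ← map_one splitTorus]
    exact congrArg splitTorus (Units.ext (by rw [Units.val_pow_eq_pow_val, hpow, Units.val_one]))
  · intro h hh
    obtain ⟨a, rfl⟩ := exists_eq_splitTorus hh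
    obtain ⟨j, -, hj⟩ := hζ.eq_pow_of_pow_eq_one (hpow a)
    refine ⟨j, ?_⟩
    rw [← map_pow]
    exact congrArg splitTorus (Units.ext (by rw [Units.val_pow_eq_pow_val]; exact hj.symm))
  · intro j
    have hu : ζ ^ j = ((u ^ j : Fˣ) : F) := by rw [Units.val_pow_eq_pow_val]; rfl
    rw [← map_pow, hu, torusMatrix_algebraMap (Or.inl (hpow _)), ← map_pow]
    exact isConj_splitTorus _

theorem sum_brauerCharacter_nonsplit {K : Type*} [Field K] [Fintype K] [Algebra F K] [Algebra K κ]
    [IsScalarTower F K κ] (hK : Fintype.card K = Fintype.card F ^ 2) {ζ : K}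
    (hζ : IsPrimitiveRoot ζ (Fintype.card F + 1)) (hζF : ζ ∉ Set.range (algebraMap F K))
    (ρ : Representation F (SpecialLinearGroup (Fin 2) F) V) :
    ∑ ζ ∈ Polynomial.nthRootsFinset (Fintype.card F + 1) (1 : κ),
        brauerCharacter (rootLift α hα ξ hξ) ρ (torusMatrix F ζ)
      = (Fintype.card F + 1 : ℕ) * finrank κ (fixedVectors (extendScalars κ ρ)
          (MulAction.stabilizer _ (eigenPoint F ζ))) := by
  have hact := act_torusMatrix_pow hζF hζ.pow_eq_one
  refine sum_brauerCharacter_eq (h₀ := torusMatrix F ζ) ρ (Nat.succ_pos _)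
    (hζ.map_of_injective (algebraMap K κ).injective) ?_ ?_
    (fun h hh => exists_eq_torusMatrix_pow hζF hζ hh) ?_
  · exact eq_of_act_eq hζF (by rw [hact, hζ.pow_eq_one, one_smul, act_one])
  · refine smul_eigenPoint_of_act_eq (c := ζ ^ 1) ?_
    rw [← hact 1, pow_one]
  · intro j
    have hj : (ζ ^ j) ^ (Fintype.card F + 1) = 1 := by
      rw [← pow_mul, mul_comm, pow_mul, hζ.pow_eq_one, one_pow]
    rw [← map_pow, torusMatrix_algebraMap (Or.inr hj)]
    exact isConj_torusMatrix_pow hK hζF hζ.pow_eq_one j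

end TorusAverages

/-! ### The quadratic subfield and the conclusion -/

theorem notMem_range_algebraMap {F K : Type*} [Field F] [Fintype F] [Field K] [Algebra F K] {ζ : K}
    (hζ : IsPrimitiveRoot ζ (Fintype.card F + 1)) : ζ ∉ Set.range (algebraMap F K) := by
  intro h
  have hF : 1 < Fintype.card F := Fintype.one_lt_card
  have h2 : ζ ^ 2 = 1 := by
    rcases eq_one_or_eq_neg_one hζ.pow_eq_one h with rfl | rfl <;> norm_num
  have := Nat.le_of_dvd two_pos (hζ.dvd_of_pow_eq_one 2 h2)
  omega

theorem exists_quadratic_subfield (F κ : Type*) [Field F] [Fintype F] [Field κ] [Fintype κ]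
    [Algebra F κ] (hκ : Even (finrank F κ)) :
    ∃ (K : Type) (_ : Field K) (_ : Fintype K) (_ : Algebra F K) (_ : Algebra K κ),
      IsScalarTower F K κ ∧ Fintype.card K = Fintype.card F ^ 2 := by
  let p := ringChar F
  have : Fact p.Prime := ⟨CharP.char_is_prime F p⟩
  let K := FiniteField.Extension F p 2
  obtain ⟨f⟩ := FiniteField.nonempty_algHom_of_finrank_dvd (F := F) (K := K) (L := κ) (by
    rw [FiniteField.finrank_extension]
    exact hκ.two_dvd)
  have := Fintype.ofFinite K
  let : Algebra K κ := f.toRingHom.toAlgebra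
  refine ⟨K, inferInstance, inferInstance, inferInstance, inferInstance,
    IsScalarTower.of_algebraMap_eq fun x => (f.commutes x).symm, ?_⟩
  rw [← Nat.card_eq_fintype_card, FiniteField.natCard_extension, Nat.card_eq_fintype_card]

end SLTwo

end

theorem mainTheorem1 {F κ V : Type*} [Field F] [Fintype F]
    [Field κ] [Fintype κ] [Algebra F κ] (hκ : Even (Module.finrank F κ))
    (α : κˣ) (hα : ∀ x : κˣ, x ∈ Subgroup.zpowers α)
    (ξ : ℂˣ) (hξ : IsPrimitiveRoot ξ (Nat.card κˣ))
    [AddCommGroup V] [Module F V] [Module.Finite F V]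
    (ρ : Representation F (Matrix.SpecialLinearGroup (Fin 2) F) V) :
    (Module.finrank F (Representation.IntertwiningMap (SLTwo.steinberg F) ρ) : ℂ) =
      1 / 2 *
        (1 / ((Fintype.card F : ℂ) - 1) *
            ∑ ζ ∈ Polynomial.nthRootsFinset (Fintype.card F - 1) (1 : κ),
              SLTwo.brauerCharacter (SLTwo.rootLift α hα ξ hξ) ρ (SLTwo.torusMatrix F ζ)
          - 1 / ((Fintype.card F : ℂ) + 1) *
            ∑ ζ ∈ Polynomial.nthRootsFinset (Fintype.card F + 1) (1 : κ),
              SLTwo.brauerCharacter (SLTwo.rootLift α hα ξ hξ) ρ (SLTwo.torusMatrix F ζ)) := by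
  obtain ⟨K, _, _, _, _, _, hK⟩ := SLTwo.exists_quadratic_subfield F κ hκ
  have hF : 1 < Fintype.card F := Fintype.one_lt_card
  -- `q ^ 2 - 1 = (q + 1) * (q - 1)`, so `K` contains a primitive `(q + 1)`-th root of unity.
  obtain ⟨ζ, hζ⟩ := SLTwo.exists_isPrimitiveRoot K (n := Fintype.card F + 1)
    ⟨Fintype.card F - 1, by rw [hK, ← Nat.sq_sub_sq, one_pow]⟩
  have hζF := SLTwo.notMem_range_algebraMap hζ
  have hmain := SLTwo.finrank_fixedVectors_split hK (SLTwo.extendScalars κ ρ)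
    (SLTwo.coordinatePoints F) SLTwo.coordinatePoints_ne
    (fun p hp => SLTwo.mem_orbit_coordinatePoints hp) (SLTwo.eigenPoint F ζ)
    (fun h => hζF (SLTwo.eigenPoint_mem_range_iff.1 h))
    (fun p hp => SLTwo.mem_orbit_eigenPoint hK hζF hζ.pow_eq_one hp)
  -- Both character sums become group order times dimension of the fixed space, and `hmain` supplies
  -- the difference of these dimensions.
  rw [SLTwo.finrank_intertwiningMap_steinberg, SLTwo.sum_brauerCharacter_split,
    SLTwo.sum_brauerCharacter_nonsplit hK hζ hζF, hmain,
    SLTwo.finrank_sumZeroMaps_extendScalars κ ρ (SLTwo.Points F F), Nat.cast_sub hF.le]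
  have h1 : (Fintype.card F : ℂ) - 1 ≠ 0 :=
    sub_ne_zero.2 (by exact_mod_cast hF.ne')
  have h2 : (Fintype.card F : ℂ) + 1 ≠ 0 := Nat.cast_add_one_ne_zero _
  push_cast
  field_simp
  ring
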